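/- Let $k$ be any field, let $m = 2n+7 \ge 9$ be odd (so $n \ge 1$), and let $v_1,\dots,v_m$ be positive integers. Then in a polynomial ring in $\sum_{i=1}^m v_i$ variables over $k$ there is a prime ideal $P$ of height $\frac{m+1}{2} = n+4$ such that $P^2$ has at least $$\prod_{i=1}^m v_i \;+\; v_1 v_2 \prod_{i=n+3}^m v_i$$ embedded primes (associated primes of $P^2$ that are not minimal over $P^2$). In particular, if all $v_i$ are equal to $v$, then $P^2$ has at least $v^{2n+7} + v^{n+7} = v^m + v^{(m+7)/2}$ embedded primes. Explicitly, $P$ can be constructed as follows. Let $J = (a^2b^2c,\, b^4,\, ab^3,\, a^3b,\, a^4) \subseteq k[a,b,c]$, and let $P_Z \subseteq S_Z = k[a,b,c,Z_1,\dots,Z_5,T]$ be the presenting ideal of the extended Rees algebra $k[a,b,c][Jt,t^{-1}]$, that is, the kernel of the $k[a,b,c]$-algebra map $S_Z \to k[a,b,c][t,t^{-1}]$ that sends $Z_i$ to $t$ times the $i$-th listed generator of $J$ and $T$ to $t^{-1}$. Spreading: let $S_U = k[a,b,c_1,\dots,c_n,U_1,\dots,U_n,Z_2,\dots,Z_5,T]$,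 a polynomial ring in $m$ variables, graded by $\mathbb{N}^n \times \mathbb{Z}$ with $\deg a = \deg b = (0,0)$, $\deg c_j = (e_j,0)$, $\deg U_j = (e_j,1)$, $\deg Z_i = (0,1)$ and $\deg T = (0,-1)$. Let $\Phi : S_U \to S_Z$ be the $k$-algebra map with $c_j \mapsto c$ and $U_j \mapsto Z_1$ that fixes the other variables, and let $P_U \subseteq S_U$ be the ideal generated by all homogeneous $f \in S_U$ with $\Phi(f) \in P_Z$. Splitting: let $x_1,\dots,x_m$ be the variables of $S_U$ in the order listed above, and let $\sigma : S_U \to k[u_{ij} : 1 \le i \le m,\ 1 \le j \le v_i]$ be the $k$-algebra map with $x_i \mapsto u_{i1}u_{i2}\cdots u_{iv_i}$. Then $P$ is the ideal generated by $\sigma(P_U)$. -/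

import Mathlib

/-! Definitions: extended Rees algebras, spreading, splitting, embedded primes. -/

namespace SpreadSplit

open MvPolynomial

noncomputable section

/-- The embedded primes of an ideal `I`: the associated primes of `R ⧸ I` that are not minimal
over `I`. -/
def embeddedPrimes {R : Type*} [CommRing R] (I : Ideal R) : Set (Ideal R) :=
  associatedPrimes R (R ⧸ I) \ I.minimalPrimes

/-- The spreading of an ideal `I` of `S` along `φ : R → S`, with respect to a grading `𝒜` of `R`:
the ideal of `R` generated by all homogeneous elements `f` with `φ f ∈ I`. -/
def spread {k M R S : Type*} [CommRing k] [CommRing R] [CommRing S] [Algebra k R] [Algebra k S]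
    (𝒜 : M → Submodule k R) (φ : R →ₐ[k] S) (I : Ideal S) : Ideal R :=
  Ideal.span {f | SetLike.IsHomogeneousElem 𝒜 f ∧ φ f ∈ I}

/-- The splitting homomorphism that sends the variable `X i` to the product of `v i` distinct
new variables `X ⟨i, 0⟩, …, X ⟨i, v i - 1⟩`. -/
def split (k : Type*) [CommRing k] {σ : Type*} (v : σ → ℕ) :
    MvPolynomial σ k →ₐ[k] MvPolynomial (Σ i : σ, Fin (v i)) k :=
  aeval fun i => ∏ j : Fin (v i), X ⟨i, j⟩

/-- The nine variables `a, b, c, Z₁, …, Z₅, T`; here `Z i` stands for `Z_{i+1}`. -/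
inductive ZVar : Type
  | a : ZVar
  | b : ZVar
  | c : ZVar
  | Z : Fin 5 → ZVar
  | T : ZVar

/-- The generators `a²b²c, b⁴, ab³, a³b, a⁴` of the ideal `J` of `k[a, b, c]`,
where `a, b, c` are `X 0, X 1, X 2`. -/
def gensJ (k : Type*) [CommRing k] : Fin 5 → MvPolynomial (Fin 3) k :=
  ![X 0 ^ 2 * X 1 ^ 2 * X 2, X 1 ^ 4, X 0 * X 1 ^ 3, X 0 ^ 3 * X 1, X 0 ^ 4]

/-- The map from `k[a, b, c, Z₁, …, Z₅, T]` to `k[a, b, c][t, t⁻¹]` that fixes `a, b, c`, sends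
`Z_i` to `t` times the `i`-th generator of `J`, and sends `T` to `t⁻¹`. Its image is the extended
Rees algebra `k[a, b, c][Jt, t⁻¹]`. -/
def extReesHom (k : Type*) [CommRing k] :
    MvPolynomial ZVar k →ₐ[k] LaurentPolynomial (MvPolynomial (Fin 3) k) :=
  aeval fun x => match x with
    | .a => LaurentPolynomial.C (X 0)
    | .b => LaurentPolynomial.C (X 1)
    | .c => LaurentPolynomial.C (X 2)
    | .Z i => LaurentPolynomial.C (gensJ k i) * LaurentPolynomial.T 1
    | .T => LaurentPolynomial.T (-1)

/-- The presenting ideal of the extended Rees algebra of `J`. -/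
def presentingIdeal (k : Type*) [CommRing k] : Ideal (MvPolynomial ZVar k) :=
  RingHom.ker (extReesHom k)

/-- The `2n+7` variables `a, b, c₁, …, c_n, U₁, …, U_n, Z₂, …, Z₅, T`; here `c j`, `U j`, `Z i`
stand for `c_{j+1}`, `U_{j+1}`, `Z_{i+2}`. -/
inductive UVar (n : ℕ) : Type
  | a : UVar n
  | b : UVar n
  | c : Fin n → UVar n
  | U : Fin n → UVar n
  | Z : Fin 4 → UVar n
  | T : UVar n

/-- The position (counted from `0`) of a variable in the list
`a, b, c₁, …, c_n, U₁, …, U_n, Z₂, …, Z₅, T`. -/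
def UVar.pos {n : ℕ} : UVar n → Fin (2 * n + 7)
  | .a => ⟨0, by omega⟩
  | .b => ⟨1, by omega⟩
  | .c j => ⟨2 + j, by omega⟩
  | .U j => ⟨n + 2 + j, by omega⟩
  | .Z i => ⟨2 * n + 2 + i, by omega⟩
  | .T => ⟨2 * n + 6, by omega⟩

/-- The surjection `k[a, b, c₁, …, c_n, U₁, …, U_n, Z₂, …, Z₅, T] → k[a, b, c, Z₁, …, Z₅, T]`
with `c_j ↦ c`, `U_j ↦ Z₁` and fixing the other variables. -/
def spreadHom (k : Type*) [CommRing k] (n : ℕ) :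
    MvPolynomial (UVar n) k →ₐ[k] MvPolynomial ZVar k :=
  rename fun x => match x with
    | .a => ZVar.a
    | .b => ZVar.b
    | .c _ => ZVar.c
    | .U _ => ZVar.Z 0
    | .Z i => ZVar.Z i.succ
    | .T => ZVar.T

/-- The degrees of the variables in `ℕⁿ × ℤ`: `a, b` have degree `(0, 0)`, `c_j` has degree
`(e_j, 0)`, `U_j` has degree `(e_j, 1)`, `Z_i` has degree `(0, 1)` and `T` has degree `(0, -1)`.
These are the degrees of `a, b, c_j, a²b²c_j t, …, t⁻¹` when `k[a, b]` is put in degree `0`. -/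
def weight (n : ℕ) : UVar n → (Fin n → ℕ) × ℤ
  | .a => (0, 0)
  | .b => (0, 0)
  | .c j => (Pi.single j 1, 0)
  | .U j => (Pi.single j 1, 1)
  | .Z _ => (0, 1)
  | .T => (0, -1)

/-- The spreading of the presenting ideal of the extended Rees algebra of `J`. -/
def spreadIdeal (k : Type*) [CommRing k] (n : ℕ) : Ideal (MvPolynomial (UVar n) k) :=
  spread (weightedHomogeneousSubmodule k (weight n)) (spreadHom k n) (presentingIdeal k)

/-- The ideal obtained from `spreadIdeal k n` by splitting its `i`-th variable into a product of
`v i` new variables, for all `i`. -/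
def splitSpreadIdeal (k : Type*) [CommRing k] (n : ℕ) (v : Fin (2 * n + 7) → ℕ) :
    Ideal (MvPolynomial (Σ i : Fin (2 * n + 7), Fin (v i)) k) :=
  ((spreadIdeal k n).map (rename (UVar.pos (n := n)) :
    MvPolynomial (UVar n) k →ₐ[k] MvPolynomial (Fin (2 * n + 7)) k)).map (split k v)

end

end SpreadSplit

/-! Every ideal in sight is toric: the kernel of a map sending each variable to a monomial, hence
determined by the degrees of the variables. Spreading refines the degree by the `ℕⁿ`-grading
(`spreadIdeal_eq`), and splitting adjoins the differences of the exponents over each old variable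
(`map_split_toricIdeal`). The target monoid algebras have no zero divisors, so all these ideals are
prime.

Height. In the spread ring each of the `n + 4` variables `U_j`, `Z_i` satisfies a relation "variable
times `T` = monomial in `a, b, c_j`". Making these variables free and then imposing the relations
one at a time gives a strict chain of toric primes ending inside `P`, so the height is at least `n +
4`. Conversely, a prime that contains all these relations and not `T` contains the whole toric
ideal, so `P` is minimal over `n + 4` elements and Krull's height theorem gives equality
(`height_map_split_toricIdeal`).

Embedded primes. Two explicit elements have colon ideals, modulo `P_U ^ 2`, generated by variables:
`witnessAll` by all of them, `witnessNoC` by all except the `c_j`. That the colon is at least this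
big is shown by polynomial identities. That it is no bigger follows from one monomial of the
witness: each factorization of it (for `witnessNoC`, of its multiples by `c`-monomials) has a factor
alone in its degree, so its coefficient vanishes on all of `P_U ^ 2`.

Splitting multiplies such primes. The split ring is free over the old one, on the monomials
divisible by no full product of the new variables over an old one. If the variables in `V` generate
a colon ideal of `I`, then picking one new variable over each element of `V` generates a colon ideal
of the extended ideal, which gives `∏ i ∈ V, v i` associated primes
(`span_choiceSet_mem_associatedPrimes`). They contain variables while `P` contains none, so they are
embedded. The two choices of `V` give the two summands. -/

namespace SpreadSplit

open MvPolynomial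

noncomputable section

/-! ### Toric ideals and isolated monomials -/

section Toric

variable {k σ M : Type*} [Field k] [AddCommMonoid M]

/-- The monomial map sending the variable `X i` to the monomial with exponent `d i`. -/
def toricHom (k : Type*) [Field k] {σ M : Type*} [AddCommMonoid M] (d : σ → M) :
    MvPolynomial σ k →ₐ[k] AddMonoidAlgebra k M :=
  aeval fun i => AddMonoidAlgebra.single (d i) 1

/-- The toric ideal of the exponent configuration `d`. -/
def toricIdeal (k : Type*) [Field k] {σ M : Type*} [AddCommMonoid M] (d : σ → M) :
    Ideal (MvPolynomial σ k) :=
  RingHom.ker (toricHom k d)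

theorem toricHom_monomial (d : σ → M) (μ : σ →₀ ℕ) (r : k) :
    toricHom k d (monomial μ r) = AddMonoidAlgebra.single (Finsupp.weight d μ) r := by
  have hm : ∀ μ : σ →₀ ℕ, toricHom k d (monomial μ 1) =
      AddMonoidAlgebra.single (Finsupp.weight d μ) 1 := by
    intro μ
    induction μ using Finsupp.induction_linear with
    | zero => rw [map_zero, monomial_zero', C_1, map_one, AddMonoidAlgebra.one_def]
    | add f g hf hg =>
      rw [← one_mul (1 : k), ← monomial_mul, map_mul, hf, hg, AddMonoidAlgebra.single_mul_single,
        map_add, one_mul]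
    | single i e =>
      rw [← X_pow_eq_monomial, map_pow, toricHom, aeval_X, AddMonoidAlgebra.single_pow, one_pow,
        Finsupp.weight_single]
  rw [← mul_one r, ← smul_eq_mul, ← smul_monomial, map_smul, hm, AddMonoidAlgebra.smul_single]

theorem toricHom_X (d : σ → M) (i : σ) :
    toricHom k d (X i) = AddMonoidAlgebra.single (d i) 1 :=
  aeval_X _ _

theorem toricHom_eq_sum (d : σ → M) (f : MvPolynomial σ k) :
    toricHom k d f =
      ∑ μ ∈ f.support, AddMonoidAlgebra.single (Finsupp.weight d μ) (coeff μ f) := by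
  conv_lhs => rw [f.as_sum, map_sum]
  simp_rw [toricHom_monomial]

theorem binomial_mem_toricIdeal {d : σ → M} {μ ν : σ →₀ ℕ} :
    (monomial μ (1 : k) - monomial ν 1) ∈ toricIdeal k d ↔
      Finsupp.weight d μ = Finsupp.weight d ν := by
  rw [toricIdeal, RingHom.mem_ker, map_sub, toricHom_monomial, toricHom_monomial, sub_eq_zero]
  constructor
  · intro h
    have h2 := congrArg (fun x => x.coeff (Finsupp.weight d μ)) h
    by_contra hne
    simp [Ne.symm hne] at h2
  · intro h
    rw [h]

/-- A toric ideal is spanned by binomials: replace each monomial of `f` by a fixed representative of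
its degree. The result is determined by the image of `f`, hence is zero, and the error is a
combination of binomials. -/
theorem toricIdeal_le {d : σ → M} {I : Ideal (MvPolynomial σ k)}
    (h : ∀ μ ν, Finsupp.weight d μ = Finsupp.weight d ν →
      (monomial μ (1 : k) - monomial ν 1) ∈ I) : toricIdeal k d ≤ I := by
  intro f hf
  classical
  let rep : M → (σ →₀ ℕ) := Function.invFun (Finsupp.weight d)
  have hrep : ∀ μ, Finsupp.weight d (rep (Finsupp.weight d μ)) = Finsupp.weight d μ := fun μ =>
    Function.invFun_eq ⟨μ, rfl⟩
  let L : AddMonoidAlgebra k M →+ MvPolynomial σ k :=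
    (AddMonoidAlgebra.mapDomainLinearMap k k rep).toAddMonoidHom
  have hL : ∀ m r, L (AddMonoidAlgebra.single m r) = monomial (rep m) r := fun m r =>
    AddMonoidAlgebra.mapDomain_single
  have h0 : ∑ μ ∈ f.support, monomial (rep (Finsupp.weight d μ)) (coeff μ f) = 0 := by
    have := congrArg L (toricHom_eq_sum d f)
    rw [show toricHom k d f = 0 from hf, map_zero, map_sum] at this
    simp_rw [hL] at this
    exact this.symm
  have h1 : f = ∑ μ ∈ f.support,
      C (coeff μ f) * (monomial μ 1 - monomial (rep (Finsupp.weight d μ)) 1) := by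
    simp_rw [mul_sub, C_mul_monomial, mul_one, Finset.sum_sub_distrib, h0, sub_zero]
    exact f.as_sum
  rw [h1]
  exact I.sum_mem fun μ _ => I.mul_mem_left _ (h _ _ (hrep μ).symm)

theorem weight_map {N : Type*} [AddCommMonoid N] (φ : M →+ N) (d : σ → M) (μ : σ →₀ ℕ) :
    φ (Finsupp.weight d μ) = Finsupp.weight (fun i => φ (d i)) μ := by
  simp [Finsupp.weight_apply, Finsupp.sum, map_sum]

theorem toricIdeal_mono {N : Type*} [AddCommMonoid N] (φ : M →+ N) {d : σ → M} {e : σ → N}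
    (h : ∀ i, φ (d i) = e i) : toricIdeal k d ≤ toricIdeal k e := by
  refine toricIdeal_le fun μ ν hμν => binomial_mem_toricIdeal.2 ?_
  obtain rfl : (fun i => φ (d i)) = e := funext h
  rw [← weight_map, ← weight_map, hμν]

theorem toricIdeal_isPrime [UniqueSums M] (d : σ → M) : (toricIdeal k d).IsPrime :=
  RingHom.ker_isPrime _

theorem X_notMem_toricIdeal (d : σ → M) (i : σ) : X i ∉ toricIdeal k d := by
  rw [toricIdeal, RingHom.mem_ker, toricHom_X]
  simp

/-- A monomial is isolated if no other monomial has the same degree. -/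
def Isolated (d : σ → M) (μ : σ →₀ ℕ) : Prop :=
  ∀ ν, Finsupp.weight d ν = Finsupp.weight d μ → ν = μ

/-- Nothing can cancel against `μ`: the image of `f` has exactly `coeff μ f` in the degree of `μ`.
-/
theorem coeff_eq_zero_of_isolated {d : σ → M} {μ : σ →₀ ℕ} (hμ : Isolated d μ)
    {f : MvPolynomial σ k} (hf : f ∈ toricIdeal k d) : coeff μ f = 0 := by
  classical
  have h : (toricHom k d f).coeff (Finsupp.weight d μ) = 0 := by
    rw [show toricHom k d f = 0 from hf]; rfl
  rw [toricHom_eq_sum, AddMonoidAlgebra.coeff_sum, Finsupp.finsetSum_apply] at h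
  by_contra hne
  rw [Finset.sum_eq_single μ] at h
  · simp at h
    exact hne h
  · intro ν _ hν
    rw [AddMonoidAlgebra.coeff_single, Finsupp.single_apply, if_neg fun e => hν (hμ ν e)]
  · intro hμ
    exact absurd (mem_support_iff.2 hne) hμ

/-- A coefficient vanishes on the square of a toric ideal if every factorization of its monomial
has an isolated factor. -/
theorem coeff_eq_zero_of_mem_toricIdeal_sq {d : σ → M} {μ : σ →₀ ℕ}
    (hμ : ∀ α β, α + β = μ → Isolated d α ∨ Isolated d β)
    {f : MvPolynomial σ k} (hf : f ∈ toricIdeal k d ^ 2) : coeff μ f = 0 := by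
  classical
  rw [pow_two] at hf
  refine Submodule.mul_induction_on hf (fun g hg h hh => ?_) fun g h hg hh => ?_
  · rw [coeff_mul]
    refine Finset.sum_eq_zero fun p hp => ?_
    rcases hμ p.1 p.2 (Finset.HasAntidiagonal.mem_antidiagonal.1 hp) with hi | hi
    · rw [coeff_eq_zero_of_isolated hi hg, zero_mul]
    · rw [coeff_eq_zero_of_isolated hi hh, mul_zero]
  · rw [coeff_add, hg, hh, add_zero]

theorem toricIdeal_map_rename {τ : Type*} (e : σ ≃ τ) (d : σ → M) :
    (toricIdeal k d).map (rename e : MvPolynomial σ k →ₐ[k] MvPolynomial τ k) =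
      toricIdeal k (d ∘ e.symm) := by
  have key : ∀ p, toricHom k (d ∘ e.symm) (rename e p) = toricHom k d p := by
    intro p
    have : (toricHom k (d ∘ e.symm)).comp (rename e) = toricHom k d := by
      ext i : 1
      simp [toricHom_X]
    exact DFunLike.congr_fun this p
  apply le_antisymm
  · rw [Ideal.map_le_iff_le_comap]
    intro p hp
    rw [Ideal.mem_comap, toricIdeal, RingHom.mem_ker]
    exact (key p).trans hp
  · intro p hp
    have hp' : rename e (rename e.symm p) = p := by simp [rename_rename]
    rw [← hp']
    refine Ideal.mem_map_of_mem (rename e) ?_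
    rw [toricIdeal, RingHom.mem_ker, ← key, hp']
    exact hp

end Toric

/-! ### The presenting ideal and its spreading are toric -/

section SpreadIdeal

/-- The exponent and the `t`-degree of the image of a variable in the extended Rees algebra. -/
def reesDegree : ZVar → ℤ × (Fin 3 →₀ ℕ)
  | .a => (0, Finsupp.single 0 1)
  | .b => (0, Finsupp.single 1 1)
  | .c => (0, Finsupp.single 2 1)
  | .Z i => (1, ![Finsupp.single 0 2 + Finsupp.single 1 2 + Finsupp.single 2 1,
      Finsupp.single 1 4, Finsupp.single 0 1 + Finsupp.single 1 3,
      Finsupp.single 0 3 + Finsupp.single 1 1, Finsupp.single 0 4] i)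
  | .T => (-1, 0)

/-- Laurent polynomials over `k[a, b, c]` are, by currying, the monoid algebra of `ℤ × (Fin 3 →₀
ℕ)`, where all generators become monomials. -/
theorem presentingIdeal_eq (k : Type*) [Field k] :
    presentingIdeal k = toricIdeal k reesDegree := by
  have key : ∀ p, extReesHom k p =
      (AddMonoidAlgebra.curryRingEquiv (toricHom k reesDegree p) :
        LaurentPolynomial (MvPolynomial (Fin 3) k)) := by
    intro p
    induction p using MvPolynomial.induction_on with
    | C r =>
      rw [show (C r : MvPolynomial ZVar k) = monomial 0 r from rfl, toricHom_monomial, map_zero,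
        show (0 : ℤ × (Fin 3 →₀ ℕ)) = (0, 0) from rfl,
        AddMonoidAlgebra.curryRingEquiv_single]
      exact (extReesHom k).commutes r
    | add p q hp hq => simp [hp, hq]
    | mul_X p x hp =>
      rw [map_mul, hp, map_mul, map_mul, toricHom_X]
      congr 1
      rw [extReesHom, aeval_X]
      cases x with
      | Z i =>
        fin_cases i <;>
        simp [reesDegree, AddMonoidAlgebra.curryRingEquiv_single, gensJ, X, monomial_pow,
          monomial_mul, ← LaurentPolynomial.single_eq_C_mul_T] <;> rfl
      | _ =>
        simp only [reesDegree, AddMonoidAlgebra.curryRingEquiv_single]; rfl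
  ext p
  rw [presentingIdeal, toricIdeal, RingHom.mem_ker, RingHom.mem_ker, key]
  simp

/-- The underlying map on variables of `spreadHom`. -/
def UVar.toZVar {n : ℕ} : UVar n → ZVar
  | .a => ZVar.a
  | .b => ZVar.b
  | .c _ => ZVar.c
  | .U _ => ZVar.Z 0
  | .Z i => ZVar.Z i.succ
  | .T => ZVar.T

theorem spreadHom_eq (k : Type*) [Field k] (n : ℕ) :
    spreadHom k n = rename UVar.toZVar := by
  unfold spreadHom
  congr 1

/-- The degree of a variable in the multigraded extended Rees algebra of
`(a²b²c_1, …, a²b²c_n, b⁴, ab³, a³b, a⁴)`. -/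
def spreadDegree (n : ℕ) (x : UVar n) : (ℤ × (Fin 3 →₀ ℕ)) × (Fin n → ℕ) :=
  (reesDegree x.toZVar, (weight n x).1)

theorem fst_weight_spreadDegree {n : ℕ} (μ : UVar n →₀ ℕ) :
    (Finsupp.weight (spreadDegree n) μ).1 =
      Finsupp.weight reesDegree (μ.mapDomain UVar.toZVar) := by
  have h := weight_map (AddMonoidHom.fst (ℤ × (Fin 3 →₀ ℕ)) (Fin n → ℕ)) (spreadDegree n) μ
  rw [AddMonoidHom.coe_fst] at h
  rw [h, Finsupp.weight_apply, Finsupp.weight_apply, Finsupp.sum_mapDomain_index]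
  · rfl
  · simp
  · intros; rw [add_smul]

theorem snd_weight_spreadDegree {n : ℕ} (μ : UVar n →₀ ℕ) :
    (Finsupp.weight (spreadDegree n) μ).2 = (Finsupp.weight (weight n) μ).1 := by
  have h := weight_map (AddMonoidHom.snd (ℤ × (Fin 3 →₀ ℕ)) (Fin n → ℕ)) (spreadDegree n) μ
  have h' := weight_map (AddMonoidHom.fst (Fin n → ℕ) ℤ) (weight n) μ
  rw [AddMonoidHom.coe_snd] at h
  rw [AddMonoidHom.coe_fst] at h'
  rw [h, h']
  rfl

theorem weight_eq_of_spreadDegree {n : ℕ} {μ ν : UVar n →₀ ℕ}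
    (h : Finsupp.weight (spreadDegree n) μ = Finsupp.weight (spreadDegree n) ν) :
    Finsupp.weight (weight n) μ = Finsupp.weight (weight n) ν := by
  let φ : (ℤ × (Fin 3 →₀ ℕ)) × (Fin n → ℕ) →+ (Fin n → ℕ) × ℤ :=
    (AddMonoidHom.snd _ _).prod ((AddMonoidHom.fst _ _).comp (AddMonoidHom.fst _ _))
  have hφ : (fun i => φ (spreadDegree n i)) = weight n := by
    funext x
    cases x <;> rfl
  have := congrArg φ h
  rwa [weight_map, weight_map, hφ] at this

/-- On an element homogeneous of degree `w`, the refined monomial map only tags every term with the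
constant `w.1`, so both maps kill it together. Conversely the binomials of the refined toric ideal
are homogeneous. The `ℤ`-part of `weight` is already the `t`-degree, so only the `ℕⁿ`-part has to be
added. -/
theorem spreadIdeal_eq (k : Type*) [Field k] (n : ℕ) :
    spreadIdeal k n = toricIdeal k (spreadDegree n) := by
  rw [spreadIdeal, spread, presentingIdeal_eq, spreadHom_eq]
  apply le_antisymm
  · rw [Ideal.span_le]
    rintro f ⟨⟨w, hw⟩, hf⟩
    let L : AddMonoidAlgebra k (ℤ × (Fin 3 →₀ ℕ)) →+
        AddMonoidAlgebra k ((ℤ × (Fin 3 →₀ ℕ)) × (Fin n → ℕ)) :=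
    (AddMonoidAlgebra.mapDomainLinearMap k k (fun m => (m, w.1))).toAddMonoidHom
    have hL : ∀ m r, L (AddMonoidAlgebra.single m r) = AddMonoidAlgebra.single (m, w.1) r :=
      fun m r => AddMonoidAlgebra.mapDomain_single
    have h1 : toricHom k (spreadDegree n) f =
        L (toricHom k reesDegree (rename UVar.toZVar f)) := by
      rw [toricHom_eq_sum]
      conv_rhs => rw [f.as_sum, map_sum, map_sum, map_sum]
      refine Finset.sum_congr rfl fun μ hμ => ?_
      rw [rename_monomial, toricHom_monomial, hL]
      congr 1
      refine Prod.ext (fst_weight_spreadDegree μ) ?_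
      rw [snd_weight_spreadDegree]
      have := (mem_weightedHomogeneousSubmodule k (weight n) w f).1 hw (mem_support_iff.1 hμ)
      rw [this]
    have h2 : toricHom k reesDegree (rename UVar.toZVar f) = 0 := hf
    rw [SetLike.mem_coe, toricIdeal, RingHom.mem_ker, h1, h2, map_zero]
  · refine toricIdeal_le fun μ ν h => Ideal.subset_span ⟨⟨Finsupp.weight (weight n) μ, ?_⟩, ?_⟩
    · refine Submodule.sub_mem _ ?_ ?_
      · exact (mem_weightedHomogeneousSubmodule k _ _ _).2
          (isWeightedHomogeneous_monomial _ _ _ rfl)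
      · exact (mem_weightedHomogeneousSubmodule k _ _ _).2
          (isWeightedHomogeneous_monomial _ _ _ (weight_eq_of_spreadDegree h).symm)
    · rw [map_sub, rename_monomial, rename_monomial]
      rw [binomial_mem_toricIdeal, ← fst_weight_spreadDegree, ← fst_weight_spreadDegree, h]

end SpreadIdeal

/-! ### Splitting variables: degrees, freeness and coordinates -/

section Degree

variable {σ M : Type*} {v : σ → ℕ} [AddCommMonoid M]

open Classical in
/-- The exponent configuration of the splitting of a toric ideal. -/
def splitDegree (z : ∀ i, Fin (v i)) (d : σ → M) (p : Σ i : σ, Fin (v i)) :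
    M × ((Σ i : σ, Fin (v i)) → ℤ) :=
  if p = ⟨p.1, z p.1⟩ then
    (d p.1, fun q => (if q = p then 1 else 0) - if q.1 = p.1 then 1 else 0)
  else (0, fun q => if q = p then 1 else 0)

/-- The distinguished new variable `⟨i, z i⟩` carries the old degree and cancels the others, so the
product over the fibre of `i` has degree `(d i, 0)`. The second component thus records exponents
relative to the distinguished one. -/
theorem snd_weight_splitDegree (z : ∀ i, Fin (v i)) (d : σ → M)
    (α : (Σ i : σ, Fin (v i)) →₀ ℕ) (q : Σ i : σ, Fin (v i)) :
    (Finsupp.weight (splitDegree z d) α).2 q = (α q : ℤ) - α ⟨q.1, z q.1⟩ := by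
  classical
  let φ : M × ((Σ i : σ, Fin (v i)) → ℤ) →+ ℤ :=
    (Pi.evalAddMonoidHom _ q).comp (AddMonoidHom.snd _ _)
  change φ (Finsupp.weight (splitDegree z d) α) = _
  induction α using Finsupp.induction_linear with
  | zero => simp
  | add f g hf hg => rw [map_add, map_add, hf, hg]; simp only [Finsupp.add_apply]; push_cast; ring
  | single p e =>
    rw [Finsupp.weight_single, map_nsmul]
    simp only [φ, AddMonoidHom.comp_apply, AddMonoidHom.coe_snd, Pi.evalAddMonoidHom_apply,
      Finsupp.single_apply, splitDegree]
    by_cases hp : p = ⟨p.1, z p.1⟩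
    · rw [if_pos hp]
      by_cases h1 : q = p
      · subst h1
        rw [← hp]; simp
      · have h2 : p = ⟨q.1, z q.1⟩ ↔ q.1 = p.1 := by
          constructor
          · intro h; rw [h]
          · intro h; rw [h]; exact hp
        simp only [if_neg h1, if_neg (Ne.symm h1), h2]
        split_ifs <;> simp
    · rw [if_neg hp]
      have h2 : p ≠ ⟨q.1, z q.1⟩ := by
        intro h; apply hp; rw [h]
      simp only [if_neg h2, eq_comm (a := q)]
      split_ifs <;> simp

end Degree

section Split

variable {k σ : Type*} [Field k] [Finite σ] {v : σ → ℕ}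

/-- The exponent of the image under `split` of the monomial with exponent `μ`. -/
def splitExp (v : σ → ℕ) : (σ →₀ ℕ) →+ ((Σ i : σ, Fin (v i)) →₀ ℕ) where
  toFun μ := Finsupp.equivFunOnFinite.symm fun p => μ p.1
  map_zero' := by ext; simp
  map_add' _ _ := by ext; simp

@[simp]
theorem splitExp_apply (μ : σ →₀ ℕ) (p : Σ i : σ, Fin (v i)) : splitExp v μ p = μ p.1 := rfl

theorem split_monomial (μ : σ →₀ ℕ) (r : k) :
    split k v (monomial μ r) = monomial (splitExp v μ) r := by
  classical
  cases nonempty_fintype σ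
  rw [split, aeval_monomial, monomial_eq]
  congr 1
  rw [Finsupp.prod_fintype _ _ (by simp), Finsupp.prod_fintype _ _ (by simp),
    Fintype.prod_sigma]
  refine Finset.prod_congr rfl fun i _ => ?_
  rw [← Finset.prod_pow]
  rfl

/-- The largest exponent `μ` such that `splitExp v μ ≤ α`. -/
def splitFloor (α : (Σ i : σ, Fin (v i)) →₀ ℕ) : σ →₀ ℕ :=
  Finsupp.equivFunOnFinite.symm fun i => ⨅ j : Fin (v i), α ⟨i, j⟩

theorem splitFloor_le (α : (Σ i : σ, Fin (v i)) →₀ ℕ) (i : σ) (j : Fin (v i)) :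
    splitFloor α i ≤ α ⟨i, j⟩ :=
  ciInf_le (OrderBot.bddBelow _) j

theorem exists_eq_splitFloor (z : ∀ i, Fin (v i)) (α : (Σ i : σ, Fin (v i)) →₀ ℕ) (i : σ) :
    ∃ j : Fin (v i), α ⟨i, j⟩ = splitFloor α i :=
  haveI : Nonempty (Fin (v i)) := ⟨z i⟩
  exists_eq_ciInf_of_finite

/-- The part of the exponent `α` left after removing `splitExp v (splitFloor α)`. -/
def splitRem (α : (Σ i : σ, Fin (v i)) →₀ ℕ) : (Σ i : σ, Fin (v i)) →₀ ℕ :=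
  α - splitExp v (splitFloor α)

theorem splitRem_apply (α : (Σ i : σ, Fin (v i)) →₀ ℕ) (p : Σ i : σ, Fin (v i)) :
    splitRem α p = α p - splitFloor α p.1 := rfl

theorem splitExp_floor_add_rem (α : (Σ i : σ, Fin (v i)) →₀ ℕ) :
    splitExp v (splitFloor α) + splitRem α = α := by
  ext ⟨i, j⟩
  have := splitFloor_le α i j
  simp only [Finsupp.add_apply, splitExp_apply, splitRem_apply]
  omega

theorem splitFloor_splitExp_add (z : ∀ i, Fin (v i)) (μ : σ →₀ ℕ)
    (α : (Σ i : σ, Fin (v i)) →₀ ℕ) : splitFloor (splitExp v μ + α) = μ + splitFloor α := by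
  ext i
  obtain ⟨j, hj⟩ := exists_eq_splitFloor z α i
  obtain ⟨l, hl⟩ := exists_eq_splitFloor z (splitExp v μ + α) i
  have h1 := splitFloor_le α i l
  have h2 := splitFloor_le (splitExp v μ + α) i j
  simp only [Finsupp.add_apply, splitExp_apply] at *
  omega

theorem splitRem_splitExp_add (z : ∀ i, Fin (v i)) (μ : σ →₀ ℕ)
    (α : (Σ i : σ, Fin (v i)) →₀ ℕ) : splitRem (splitExp v μ + α) = splitRem α := by
  ext p
  rw [splitRem_apply, splitRem_apply, splitFloor_splitExp_add z]
  simp only [Finsupp.add_apply, splitExp_apply]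
  omega

section Toric

variable {M : Type*} [AddCommMonoid M]

theorem weight_splitDegree_splitExp (z : ∀ i, Fin (v i)) (d : σ → M) (μ : σ →₀ ℕ) :
    Finsupp.weight (splitDegree z d) (splitExp v μ) = (Finsupp.weight d μ, 0) := by
  classical
  refine Prod.ext ?_ (funext fun q => ?_)
  · cases nonempty_fintype σ
    have h := weight_map (AddMonoidHom.fst M ((Σ i : σ, Fin (v i)) → ℤ)) (splitDegree z d)
      (splitExp v μ)
    rw [AddMonoidHom.coe_fst] at h
    rw [h, Finsupp.weight_apply, Finsupp.weight_apply, Finsupp.sum_fintype _ _ (by simp),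
      Finsupp.sum_fintype _ _ (by simp), Fintype.sum_sigma]
    refine Finset.sum_congr rfl fun i _ => ?_
    rw [Finset.sum_eq_single (z i)]
    · simp [splitDegree]
    · intro j _ hj
      simp [splitDegree, hj]
    · simp
  · rw [snd_weight_splitDegree]
    simp

/-- Exponent differences determine the exponents on each fibre up to a common shift, and subtracting
the minimum removes the shift. -/
theorem splitRem_eq_of_weight_eq (z : ∀ i, Fin (v i)) {d : σ → M}
    {α β : (Σ i : σ, Fin (v i)) →₀ ℕ}
    (h : Finsupp.weight (splitDegree z d) α = Finsupp.weight (splitDegree z d) β) :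
    splitRem α = splitRem β := by
  ext ⟨i, j⟩
  have hq : ∀ l : Fin (v i), (α ⟨i, l⟩ : ℤ) - α ⟨i, z i⟩ = β ⟨i, l⟩ - β ⟨i, z i⟩ := fun l => by
    have := congrArg (fun x => x.2 ⟨i, l⟩) h
    simpa only [snd_weight_splitDegree] using this
  obtain ⟨l, hl⟩ := exists_eq_splitFloor z α i
  obtain ⟨l', hl'⟩ := exists_eq_splitFloor z β i
  have h1 := splitFloor_le α i l'
  have h2 := splitFloor_le β i l
  have h3 := splitFloor_le α i j
  have h4 := splitFloor_le β i j
  have := hq l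
  have := hq l'
  have := hq j
  simp only [splitRem_apply]
  omega

theorem split_mem_toricIdeal (z : ∀ i, Fin (v i)) {d : σ → M} {p : MvPolynomial σ k} :
    split k v p ∈ toricIdeal k (splitDegree z d) ↔ p ∈ toricIdeal k d := by
  let ι : M → M × ((Σ i : σ, Fin (v i)) → ℤ) := fun m => (m, 0)
  have hinj : Function.Injective ι := fun a b h => congrArg Prod.fst h
  let L : AddMonoidAlgebra k M →+ AddMonoidAlgebra k (M × ((Σ i : σ, Fin (v i)) → ℤ)) :=
    (AddMonoidAlgebra.mapDomainLinearMap k k ι).toAddMonoidHom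
  have hL : ∀ m r, L (AddMonoidAlgebra.single m r) = AddMonoidAlgebra.single (m, 0) r :=
    fun m r => AddMonoidAlgebra.mapDomain_single
  have hLi : Function.Injective L := AddMonoidAlgebra.mapDomain_injective hinj
  have h1 : toricHom k (splitDegree z d) (split k v p) = L (toricHom k d p) := by
    rw [toricHom_eq_sum d, map_sum]
    conv_lhs => rw [p.as_sum, map_sum, map_sum]
    refine Finset.sum_congr rfl fun μ _ => ?_
    rw [split_monomial, toricHom_monomial, hL, weight_splitDegree_splitExp]
  rw [toricIdeal, toricIdeal, RingHom.mem_ker, RingHom.mem_ker, h1]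
  exact map_eq_zero_iff L hLi

/-- Two exponents of equal degree have the same remainder, so their binomial is a monomial times the
image of a binomial in the old variables. -/
theorem map_split_toricIdeal [IsCancelAdd M] (z : ∀ i, Fin (v i)) (d : σ → M) :
    (toricIdeal k d).map (split k v) = toricIdeal k (splitDegree z d) := by
  apply le_antisymm
  · rw [Ideal.map_le_iff_le_comap]
    intro p hp
    rw [Ideal.mem_comap]
    exact (split_mem_toricIdeal z).2 hp
  · refine toricIdeal_le fun α β h => ?_
    have hr := splitRem_eq_of_weight_eq z h
    have hw : Finsupp.weight d (splitFloor α) = Finsupp.weight d (splitFloor β) := by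
      rw [← splitExp_floor_add_rem α, ← splitExp_floor_add_rem β, hr, map_add, map_add] at h
      have := add_right_cancel h
      rw [weight_splitDegree_splitExp, weight_splitDegree_splitExp] at this
      exact congrArg Prod.fst this
    have he : monomial α (1 : k) - monomial β 1 = monomial (splitRem α) 1 *
        split k v (monomial (splitFloor α) 1 - monomial (splitFloor β) 1) := by
      rw [map_sub, split_monomial, split_monomial, mul_sub, monomial_mul, monomial_mul, one_mul,
        add_comm, splitExp_floor_add_rem, add_comm, hr, splitExp_floor_add_rem]
    rw [he]
    exact Ideal.mul_mem_left _ _ (Ideal.mem_map_of_mem _ (binomial_mem_toricIdeal.2 hw))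

theorem map_split_toricIdeal_isPrime [IsCancelAdd M] [UniqueSums M] (z : ∀ i, Fin (v i)) (d : σ → M) :
    ((toricIdeal k d).map (split k v)).IsPrime := by
  rw [map_split_toricIdeal z]
  exact toricIdeal_isPrime _

end Toric

section Coordinates

open Classical in
/-- The coordinate of a polynomial, over the ring of polynomials in the unsplit variables,
with respect to the monomial with exponent `β`. -/
def splitCoord (k : Type*) [Field k] (β : (Σ i : σ, Fin (v i)) →₀ ℕ) :
    MvPolynomial (Σ i : σ, Fin (v i)) k →ₗ[k] MvPolynomial σ k :=
  (basisMonomials (Σ i : σ, Fin (v i)) k).constr k fun α =>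
    if splitRem α = β then monomial (splitFloor α) 1 else 0

open Classical in
theorem splitCoord_monomial (α β : (Σ i : σ, Fin (v i)) →₀ ℕ) (r : k) :
    splitCoord k β (monomial α r) = if splitRem α = β then monomial (splitFloor α) r else 0 := by
  have h := (basisMonomials (Σ i : σ, Fin (v i)) k).constr_basis k (fun α =>
    if splitRem α = β then monomial (splitFloor α) (1 : k) else 0) α
  rw [coe_basisMonomials] at h
  rw [← mul_one r, ← smul_eq_mul, ← smul_monomial, map_smul, splitCoord, h]
  split_ifs
  · rw [smul_monomial]
  · rw [smul_zero]

/-- Linearity over the old ring. It makes membership in an extended ideal testable on coordinates,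
as in `splitCoord_mem`. -/
theorem splitCoord_split_mul (z : ∀ i, Fin (v i)) (β : (Σ i : σ, Fin (v i)) →₀ ℕ)
    (s : MvPolynomial σ k) (f : MvPolynomial (Σ i : σ, Fin (v i)) k) :
    splitCoord k β (SpreadSplit.split k v s * f) = s * splitCoord k β f := by
  classical
  induction f using MvPolynomial.induction_on' with
  | add p q hp hq => rw [mul_add, map_add, hp, hq, map_add, mul_add]
  | monomial α r =>
    induction s using MvPolynomial.induction_on' with
    | add p q hp hq => rw [map_add, add_mul, map_add, hp, hq, add_mul]
    | monomial μ t =>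
      rw [split_monomial, monomial_mul, splitCoord_monomial, splitCoord_monomial,
        splitRem_splitExp_add z, splitFloor_splitExp_add z]
      split_ifs
      · rw [monomial_mul]
      · rw [mul_zero]

theorem splitCoord_mem (z : ∀ i, Fin (v i)) (β : (Σ i : σ, Fin (v i)) →₀ ℕ)
    {I : Ideal (MvPolynomial σ k)} {f : MvPolynomial (Σ i : σ, Fin (v i)) k}
    (hf : f ∈ I.map (SpreadSplit.split k v)) : splitCoord k β f ∈ I := by
  rw [Ideal.map] at hf
  suffices h : ∀ g, splitCoord k β (g * f) ∈ I by simpa using h 1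
  induction hf using Submodule.span_induction with
  | mem x hx =>
    obtain ⟨s, hs, rfl⟩ := hx
    intro g
    rw [mul_comm]
    exact splitCoord_split_mul z β s g ▸ I.mul_mem_right _ hs
  | zero => intro g; rw [mul_zero, map_zero]; exact I.zero_mem
  | add x y _ _ hx hy => intro g; rw [mul_add, map_add]; exact I.add_mem (hx g) (hy g)
  | smul a x _ hx => intro g; rw [smul_eq_mul, ← mul_assoc]; exact hx _

theorem coeff_splitCoord (α : (Σ i : σ, Fin (v i)) →₀ ℕ)
    (f : MvPolynomial (Σ i : σ, Fin (v i)) k) :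
    coeff (splitFloor α) (splitCoord k (splitRem α) f) = coeff α f := by
  classical
  induction f using MvPolynomial.induction_on' with
  | add p q hp hq => rw [map_add, coeff_add, hp, hq, coeff_add]
  | monomial γ r =>
    rw [splitCoord_monomial, coeff_monomial]
    by_cases h : γ = α
    · subst h; simp
    · rw [if_neg h]
      split_ifs with hr
      · rw [coeff_monomial, if_neg]
        intro hf
        apply h
        rw [← splitExp_floor_add_rem γ, ← splitExp_floor_add_rem α, hr, hf]
      · simp

end Coordinates

end Split

/-! ### Height of a split toric ideal -/

section Height

variable {k σ M : Type*} [Field k]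

open Classical in
/-- The configuration obtained from `d` by making the variables in `A` free. -/
def freeDegree [AddCommMonoid M] (d : σ → M) (A : Finset σ) (x : σ) : M × (σ →₀ ℕ) :=
  if x ∈ A then (0, Finsupp.single x 1) else (d x, 0)

theorem toricIdeal_freeDegree_anti [AddCommMonoid M] (d : σ → M) {A B : Finset σ} (h : B ⊆ A) :
    toricIdeal k (freeDegree d A) ≤ toricIdeal k (freeDegree d B) := by
  refine toricIdeal_mono (AddMonoidHom.coprod (AddMonoidHom.inl M (σ →₀ ℕ))
    ((Finsupp.weight (freeDegree d B) : (σ →₀ ℕ) →+ M × (σ →₀ ℕ)))) fun x => ?_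
  by_cases hA : x ∈ A
  · rw [freeDegree, if_pos hA, AddMonoidHom.coprod_apply, map_zero, zero_add]
    simp [Finsupp.weight_single]
  · rw [freeDegree, if_neg hA, AddMonoidHom.coprod_apply, freeDegree, if_neg fun hB => hA (h hB)]
    simp

theorem toricIdeal_freeDegree_empty_le [AddCommMonoid M] (d : σ → M) :
    toricIdeal k (freeDegree d ∅) ≤ toricIdeal k d :=
  toricIdeal_mono (AddMonoidHom.fst M (σ →₀ ℕ)) fun x => by simp [freeDegree]

theorem weight_freeDegree_of_disjoint [AddCommMonoid M] (d : σ → M) {A : Finset σ} {μ : σ →₀ ℕ}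
    (h : ∀ x ∈ A, μ x = 0) :
    Finsupp.weight (freeDegree d A) μ = (Finsupp.weight d μ, 0) := by
  rw [show (Finsupp.weight d μ, (0 : σ →₀ ℕ)) = AddMonoidHom.inl M (σ →₀ ℕ) (Finsupp.weight d μ)
    from rfl, weight_map, Finsupp.weight_apply, Finsupp.weight_apply]
  refine Finsupp.sum_congr fun x hx => ?_
  rw [freeDegree, if_neg fun hA => (Finsupp.mem_support_iff.1 hx) (h x hA)]
  rfl

theorem snd_weight_freeDegree [AddCommMonoid M] (d : σ → M) {A : Finset σ} {μ : σ →₀ ℕ} {x : σ}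
    (hx : x ∈ A) : (Finsupp.weight (freeDegree d A) μ).2 x = μ x := by
  classical
  let φ : M × (σ →₀ ℕ) →+ ℕ := (Finsupp.applyAddHom x).comp (AddMonoidHom.snd _ _)
  change φ (Finsupp.weight (freeDegree d A) μ) = _
  induction μ using Finsupp.induction_linear with
  | zero => simp
  | add f g hf hg => rw [map_add, map_add, hf, hg]; rfl
  | single y e =>
    rw [Finsupp.weight_single, map_nsmul]
    by_cases hy : y ∈ A
    · simp [φ, freeDegree, hy, Finsupp.single_apply]
    · have hyx : y ≠ x := fun h => hy (h ▸ hx)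
      simp [φ, freeDegree, hy, hyx]

/-- Modulo `I`, multiplying by a power of `X t` turns any monomial into one free of `W`, and such
monomials are determined by their degree. The power of `X t` can then be cancelled because `I` is
prime. -/
theorem toricIdeal_le_of_isPrime [AddCommMonoid M] {d : σ → M} {W : Finset σ} {t : σ}
    (ht : t ∉ W) (g : σ → σ →₀ ℕ) (hg : ∀ w ∈ W, Finsupp.weight d (g w) = d w + d t)
    (hgW : ∀ w ∈ W, ∀ x ∈ W, g w x = 0)
    (hinj : ∀ μ ν : σ →₀ ℕ, (∀ x ∈ W, μ x = 0) → (∀ x ∈ W, ν x = 0) →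
      Finsupp.weight d μ = Finsupp.weight d ν → μ = ν)
    {I : Ideal (MvPolynomial σ k)} [I.IsPrime] (htI : X t ∉ I)
    (hI : ∀ w ∈ W, X w * X t - monomial (g w) 1 ∈ I) : toricIdeal k d ≤ I := by
  classical
  have htW : ∀ x ∈ W, t ≠ x := fun x hx h => ht (h ▸ hx)
  have red : ∀ μ : σ →₀ ℕ, ∃ (r : ℕ) (ν : σ →₀ ℕ), (∀ x ∈ W, ν x = 0) ∧
      Finsupp.weight d ν = r • d t + Finsupp.weight d μ ∧
      Ideal.Quotient.mk I (X t ^ r * monomial μ 1) = Ideal.Quotient.mk I (monomial ν 1) := by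
    have hone : ∀ i : σ, ∃ (r : ℕ) (ν : σ →₀ ℕ), (∀ x ∈ W, ν x = 0) ∧
        Finsupp.weight d ν = r • d t + d i ∧
        Ideal.Quotient.mk I (X t ^ r * monomial (Finsupp.single i 1) 1) = Ideal.Quotient.mk I (monomial ν 1) := by
      intro i
      by_cases hi : i ∈ W
      · refine ⟨1, g i, hgW i hi, by rw [hg i hi, one_smul, add_comm], ?_⟩
        rw [Ideal.Quotient.eq, pow_one, mul_comm]
        exact hI i hi
      · refine ⟨0, Finsupp.single i 1, fun x hx => ?_, by simp [Finsupp.weight_single], ?_⟩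
        · exact Finsupp.single_eq_of_ne fun h => hi (h ▸ hx)
        · rw [pow_zero, one_mul]
    have hmul : ∀ (p q : MvPolynomial σ k) (m m' : M),
        (∃ (r : ℕ) (ν : σ →₀ ℕ), (∀ x ∈ W, ν x = 0) ∧ Finsupp.weight d ν = r • d t + m ∧
          Ideal.Quotient.mk I (X t ^ r * p) = Ideal.Quotient.mk I (monomial ν 1)) →
        (∃ (r : ℕ) (ν : σ →₀ ℕ), (∀ x ∈ W, ν x = 0) ∧ Finsupp.weight d ν = r • d t + m' ∧
          Ideal.Quotient.mk I (X t ^ r * q) = Ideal.Quotient.mk I (monomial ν 1)) →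
        ∃ (r : ℕ) (ν : σ →₀ ℕ), (∀ x ∈ W, ν x = 0) ∧
          Finsupp.weight d ν = r • d t + (m + m') ∧
          Ideal.Quotient.mk I (X t ^ r * (p * q)) = Ideal.Quotient.mk I (monomial ν 1) := by
      rintro p q m m' ⟨r, ν, h1, h2, h3⟩ ⟨r', ν', h1', h2', h3'⟩
      refine ⟨r + r', ν + ν', fun x hx => ?_, ?_, ?_⟩
      · rw [Finsupp.add_apply, h1 x hx, h1' x hx]
      · rw [map_add, h2, h2', add_smul]; abel
      · have h : X t ^ (r + r') * (p * q) = (X t ^ r * p) * (X t ^ r' * q) := by ring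
        rw [h, map_mul, h3, h3', ← map_mul, monomial_mul, one_mul]
    intro μ
    induction μ using Finsupp.induction_linear with
    | zero => exact ⟨0, 0, fun _ _ => rfl, by simp, by rw [pow_zero, one_mul]⟩
    | add f f' hf hf' =>
      have := hmul _ _ _ _ hf hf'
      rwa [monomial_mul, one_mul, ← map_add] at this
    | single i e =>
      induction e with
      | zero => exact ⟨0, 0, fun _ _ => rfl, by simp, by simp⟩
      | succ e ih =>
        have := hmul _ _ _ _ ih (hone i)
        rwa [monomial_mul, one_mul, ← Finsupp.single_add, Finsupp.weight_single,
          ← succ_nsmul, ← Finsupp.weight_single] at this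
  refine toricIdeal_le fun μ ν h => ?_
  obtain ⟨r, α, hα, hα', hα''⟩ := red μ
  obtain ⟨s, β, hβ, hβ', hβ''⟩ := red ν
  -- The two reductions may use different powers of `X t`; adding the exponents crosswise makes the
  -- degrees agree, and `t ∉ W` keeps both sides free of `W`.
  have h1 : α + Finsupp.single t s = β + Finsupp.single t r := by
    apply hinj
    · intro x hx
      simp [hα x hx, htW x hx]
    · intro x hx
      simp [hβ x hx, htW x hx]
    · rw [map_add, map_add, hα', hβ', h, Finsupp.weight_single, Finsupp.weight_single]
      abel
  have h2 : Ideal.Quotient.mk I (X t ^ (r + s) * monomial μ 1) =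
      Ideal.Quotient.mk I (X t ^ (r + s) * monomial ν 1) := by
    calc _ = Ideal.Quotient.mk I (X t ^ r * monomial μ 1) * Ideal.Quotient.mk I (X t ^ s) := by
          rw [← map_mul]; congr 1; ring
      _ = Ideal.Quotient.mk I (monomial (α + Finsupp.single t s) 1) := by
          rw [hα'', ← map_mul, X_pow_eq_monomial, monomial_mul, one_mul]
      _ = Ideal.Quotient.mk I (X t ^ s * monomial ν 1) * Ideal.Quotient.mk I (X t ^ r) := by
          rw [h1, hβ'', ← map_mul, X_pow_eq_monomial, monomial_mul, one_mul]
      _ = _ := by rw [← map_mul]; congr 1; ring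
  rw [Ideal.Quotient.eq, ← mul_sub] at h2
  exact (Ideal.IsPrime.mem_or_mem ‹_› h2).resolve_left
    fun h => htI (Ideal.IsPrime.mem_of_pow_mem ‹_› _ h)

variable [AddCommMonoid M] [IsCancelAdd M] [UniqueSums M] [Finite σ] {v : σ → ℕ}

theorem card_le_height_map_split_toricIdeal (z : ∀ i, Fin (v i)) {d : σ → M} {W : Finset σ} {t : σ}
    (ht : t ∉ W) (g : σ → σ →₀ ℕ) (hg : ∀ w ∈ W, Finsupp.weight d (g w) = d w + d t)
    (hgW : ∀ w ∈ W, ∀ x ∈ W, g w x = 0) :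
    (W.card : ℕ∞) ≤ ((toricIdeal k d).map (split k v)).height := by
  classical
  have key : ∀ s : Finset σ, s ⊆ W →
      (s.card : ℕ∞) ≤ ((toricIdeal k (freeDegree d (W \ s))).map (split k v)).height := by
    intro s
    induction s using Finset.induction_on with
    | empty => intro; simp
    | insert w s hws ih =>
      intro hs
      have hwW : w ∈ W := hs (Finset.mem_insert_self _ _)
      have hp1 := map_split_toricIdeal_isPrime (k := k) z (freeDegree d (W \ s))
      have hp2 := map_split_toricIdeal_isPrime (k := k) z (freeDegree d (W \ insert w s))
      rw [Finset.card_insert_of_notMem hws]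
      push_cast
      refine (add_le_add_left (ih fun x hx => hs (Finset.mem_insert_of_mem hx)) 1).trans
        (Ideal.height_add_one_le_of_lt_of_isPrime (lt_of_le_of_ne (Ideal.map_mono
          (toricIdeal_freeDegree_anti d (Finset.sdiff_subset_sdiff subset_rfl
            (Finset.subset_insert _ _)))) fun hEq => ?_))
      -- The inclusion is strict: the relation for `w` lies in the larger ideal, but in the smaller
      -- one `w` is still free, and it has exponent 1 in one term and 0 in the other.
      have hmem : split k v (monomial (Finsupp.single w 1 + Finsupp.single t 1) 1 -
          monomial (g w) 1) ∈ (toricIdeal k (freeDegree d (W \ s))).map (split k v) := by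
        rw [hEq]
        refine Ideal.mem_map_of_mem _ (binomial_mem_toricIdeal.2 ?_)
        rw [weight_freeDegree_of_disjoint, weight_freeDegree_of_disjoint, hg w hwW, map_add,
          Finsupp.weight_single, Finsupp.weight_single, one_smul, one_smul]
        · intro x hx
          exact hgW w hwW x (Finset.mem_sdiff.1 hx).1
        · intro x hx
          rw [Finset.mem_sdiff, Finset.mem_insert, not_or] at hx
          have hxt : t ≠ x := fun h => ht (h ▸ hx.1)
          simp [hxt, Ne.symm hx.2.1]
      rw [map_split_toricIdeal z, split_mem_toricIdeal, binomial_mem_toricIdeal] at hmem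
      have hw : w ∈ W \ s := Finset.mem_sdiff.2 ⟨hwW, hws⟩
      have h2 := congrArg (fun x => x.2 w) hmem
      simp only [snd_weight_freeDegree d hw, hgW w hwW w hwW] at h2
      simp at h2
  refine (key W subset_rfl).trans ?_
  rw [Finset.sdiff_self]
  exact Ideal.height_mono (Ideal.map_mono (toricIdeal_freeDegree_empty_le d))

theorem height_map_split_toricIdeal (z : ∀ i, Fin (v i)) {d : σ → M} {W : Finset σ} {t : σ}
    (ht : t ∉ W) (g : σ → σ →₀ ℕ) (hg : ∀ w ∈ W, Finsupp.weight d (g w) = d w + d t)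
    (hgW : ∀ w ∈ W, ∀ x ∈ W, g w x = 0)
    (hinj : ∀ μ ν : σ →₀ ℕ, (∀ x ∈ W, μ x = 0) → (∀ x ∈ W, ν x = 0) →
      Finsupp.weight d μ = Finsupp.weight d ν → μ = ν) :
    ((toricIdeal k d).map (split k v)).height = W.card := by
  classical
  refine le_antisymm ?_ (card_le_height_map_split_toricIdeal z ht g hg hgW)
  have hp := map_split_toricIdeal_isPrime (k := k) z d
  let F : Finset (MvPolynomial (Σ i : σ, Fin (v i)) k) :=
    W.image fun w => split k v (X w * X t - monomial (g w) 1)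
  have hmem : ∀ w ∈ W, X w * X t - monomial (g w) 1 ∈ toricIdeal k d := by
    intro w hw
    rw [X, X, monomial_mul, one_mul, binomial_mem_toricIdeal, hg w hw, map_add,
      Finsupp.weight_single, Finsupp.weight_single, one_smul, one_smul]
  refine (Ideal.height_le_card_of_mem_minimalPrimes_span_finset (s := F) ?_).trans
    (by exact_mod_cast Finset.card_image_le)
  refine ⟨⟨hp, ?_⟩, ?_⟩
  · rw [Ideal.span_le]
    intro x hx
    obtain ⟨w, hw, rfl⟩ := Finset.mem_image.1 hx
    exact Ideal.mem_map_of_mem _ (hmem w hw)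
  -- Minimality is checked on the contraction of `J` to the old ring; it omits `X t` because `J`
  -- lies inside the toric prime, which contains no old variable's image.
  · rintro J ⟨hJ, hFJ⟩ hJP
    rw [Ideal.map_le_iff_le_comap]
    have := hJ
    refine toricIdeal_le_of_isPrime ht g hg hgW hinj (fun h => ?_) fun w hw => ?_
    · have h' := hJP h
      rw [map_split_toricIdeal z] at h'
      exact X_notMem_toricIdeal d t ((split_mem_toricIdeal z).1 h')
    · exact hFJ (Ideal.subset_span (Finset.mem_image_of_mem _ hw))

end Height

/-! ### Primes generated by variables; associated and embedded primes -/

section MonomialPrimes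

variable {k σ : Type*} [Field k]

theorem isPrime_span_X_image (s : Set σ) :
    (Ideal.span (X '' s : Set (MvPolynomial σ k))).IsPrime := by
  classical
  let θ : MvPolynomial σ k →ₐ[k] MvPolynomial σ k := aeval fun i => if i ∈ s then 0 else X i
  have hθ : ∀ f, Ideal.Quotient.mkₐ k (Ideal.span (X '' s : Set (MvPolynomial σ k))) (θ f) =
      Ideal.Quotient.mkₐ k _ f := by
    intro f
    have : (Ideal.Quotient.mkₐ k (Ideal.span (X '' s : Set (MvPolynomial σ k)))).comp θ =
        Ideal.Quotient.mkₐ k _ := by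
      ext i
      simp only [θ, AlgHom.comp_apply, aeval_X]
      split_ifs with h
      · rw [map_zero]
        exact (Ideal.Quotient.eq_zero_iff_mem.2 (Ideal.subset_span (Set.mem_image_of_mem X h))).symm
      · rfl
    exact DFunLike.congr_fun this f
  have h : Ideal.span (X '' s : Set (MvPolynomial σ k)) = RingHom.ker θ := by
    apply le_antisymm
    · rw [Ideal.span_le]
      rintro _ ⟨i, hi, rfl⟩
      simp [θ, hi]
    · intro f hf
      have := hθ f
      rw [show θ f = 0 from hf, map_zero] at this
      exact Ideal.Quotient.eq_zero_iff_mem.1 this.symm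
  rw [h]
  exact RingHom.ker_isPrime θ

theorem X_mem_span_X_image {s : Set σ} {i : σ} :
    (X i : MvPolynomial σ k) ∈ Ideal.span (X '' s : Set (MvPolynomial σ k)) ↔ i ∈ s := by
  classical
  rw [mem_ideal_span_X_image, support_X]
  simp [Finsupp.single_apply]

end MonomialPrimes

theorem mem_associatedPrimes_of_colon {R : Type*} [CommRing R] {I Q : Ideal R} (hQ : Q.IsPrime)
    (w : R) (h : ∀ f, f * w ∈ I ↔ f ∈ Q) : Q ∈ associatedPrimes R (R ⧸ I) := by
  refine ⟨hQ, Ideal.Quotient.mk I w, ?_⟩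
  have : Submodule.colon (⊥ : Submodule R (R ⧸ I)) {Ideal.Quotient.mk I w} = Q := by
    ext f
    rw [Submodule.mem_colon_singleton, Submodule.mem_bot, ← h f, ← Ideal.Quotient.eq_zero_iff_mem,
      map_mul]
    rfl
  rw [this, hQ.radical]

/-- Every prime over `P ^ 2` contains `P`, so a minimal one would lie in `P`. -/
theorem mem_embeddedPrimes_sq {R : Type*} [CommRing R] {P Q : Ideal R} (hP : P.IsPrime)
    (hQ : Q ∈ associatedPrimes R (R ⧸ P ^ 2)) (hne : ¬ Q ≤ P) : Q ∈ embeddedPrimes (P ^ 2) := by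
  refine ⟨hQ, fun hmin => hne (hmin.2 ⟨hP, Ideal.pow_le_self two_ne_zero⟩ ?_)⟩
  exact fun x hx => hmin.1.1.mem_of_pow_mem 2 (hmin.1.2 (Ideal.pow_mem_pow hx 2))

/-! ### Associated primes of a split ideal -/

section SplitAssociated

variable {k σ : Type*} [Field k] {v : σ → ℕ}

/-- The variables over `V` picked out by the choice function `j`. -/
def choiceSet {V : Set σ} (j : ∀ i : V, Fin (v i)) : Set (Σ i : σ, Fin (v i)) :=
  Set.range fun i : V => ⟨i, j i⟩

theorem mem_choiceSet {V : Set σ} {j : ∀ i : V, Fin (v i)} {i : σ} (hi : i ∈ V) {l : Fin (v i)} :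
    (⟨i, l⟩ : Σ i : σ, Fin (v i)) ∈ choiceSet j ↔ l = j ⟨i, hi⟩ := by
  constructor
  · rintro ⟨⟨i', hi'⟩, h⟩
    obtain ⟨rfl, h⟩ := Sigma.mk.inj_iff.1 h
    exact (eq_of_heq h).symm
  · rintro rfl
    exact ⟨⟨i, hi⟩, rfl⟩

theorem fst_mem_of_mem_choiceSet {V : Set σ} {j : ∀ i : V, Fin (v i)} {p : Σ i : σ, Fin (v i)}
    (hp : p ∈ choiceSet j) : p.1 ∈ V := by
  obtain ⟨i, rfl⟩ := hp
  exact i.2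

theorem span_choiceSet_mem_associatedPrimes [Finite σ] (z : ∀ i, Fin (v i)) {I : Ideal (MvPolynomial σ k)}
    {w : MvPolynomial σ k} {V : Set σ}
    (hw : ∀ f, f * w ∈ I ↔ f ∈ Ideal.span (X '' V : Set (MvPolynomial σ k)))
    (j : ∀ i : V, Fin (v i)) :
    Ideal.span (X '' choiceSet j) ∈ associatedPrimes (MvPolynomial (Σ i : σ, Fin (v i)) k)
      (MvPolynomial (Σ i : σ, Fin (v i)) k ⧸ I.map (split k v)) := by
  classical
  -- `ρ` is the product of the new variables over `V` that were not chosen: one chosen variable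
  -- completes it to a full product over `i`.
  let ρ : (Σ i : σ, Fin (v i)) →₀ ℕ := Finsupp.equivFunOnFinite.symm fun p =>
    if p.1 ∈ V ∧ p ∉ choiceSet j then 1 else 0
  have hρ : ∀ p, ρ p = if p.1 ∈ V ∧ p ∉ choiceSet j then 1 else 0 := fun _ => rfl
  refine mem_associatedPrimes_of_colon (isPrime_span_X_image _)
    (split k v w * monomial ρ 1) fun f => ⟨fun hf => ?_, fun hf => ?_⟩
  · rw [mem_ideal_span_X_image]
    intro α hα
    by_contra! hcon
    have h1 : split k v w * (f * monomial ρ 1) ∈ I.map (split k v) := by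
      rw [mul_left_comm]; exact hf
    -- If `α` avoids the chosen variables, so does `α + ρ`; then its floor vanishes on `V`, yet it
    -- occurs in a coordinate lying in the ideal generated by `V`.
    have h2 := splitCoord_mem z (splitRem (α + ρ)) h1
    rw [splitCoord_split_mul z, mul_comm, hw, mem_ideal_span_X_image] at h2
    have h3 : coeff (splitFloor (α + ρ)) (splitCoord k (splitRem (α + ρ)) (f * monomial ρ 1)) =
        coeff α f := by
      rw [coeff_splitCoord, coeff_mul_monomial, mul_one]
    obtain ⟨i, hi, hne⟩ := h2 (splitFloor (α + ρ)) (by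
      rw [mem_support_iff, h3]
      exact mem_support_iff.1 hα)
    have h4 := splitFloor_le (α + ρ) i (j ⟨i, hi⟩)
    have h5 : (⟨i, j ⟨i, hi⟩⟩ : Σ i : σ, Fin (v i)) ∈ choiceSet j := (mem_choiceSet hi).2 rfl
    rw [Finsupp.add_apply, hcon _ h5, hρ, if_neg (fun h => h.2 h5)] at h4
    omega
  · suffices h : Ideal.span (X '' choiceSet j) ≤ (I.map (split k v)).colon
        ({split k v w * monomial ρ 1} : Set _) from
      Submodule.mem_colon_singleton.1 (h hf)
    rw [Ideal.span_le]
    rintro _ ⟨_, ⟨⟨i, hi⟩, rfl⟩, rfl⟩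
    rw [SetLike.mem_coe, Submodule.mem_colon_singleton, smul_eq_mul, mul_left_comm, X,
      monomial_mul, one_mul]
    set β : (Σ i : σ, Fin (v i)) →₀ ℕ := Finsupp.single ⟨i, j ⟨i, hi⟩⟩ 1 + ρ with hβ
    have hle : splitExp v (Finsupp.single i 1) ≤ β := by
      rintro ⟨i', l⟩
      by_cases h : i = i'
      · subst h
        by_cases hl : l = j ⟨i, hi⟩
        · subst hl
          simp [hβ]
        · have : (⟨i, l⟩ : Σ i : σ, Fin (v i)) ∉ choiceSet j := fun h => hl ((mem_choiceSet hi).1 h)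
          simp [hβ, hρ, hi, this]
      · simp [h]
    obtain ⟨γ, hγ⟩ := exists_add_of_le hle
    have : split k v w * monomial β 1 = split k v (X i * w) * monomial γ 1 := by
      rw [map_mul, X, split_monomial, mul_comm (monomial _ _), mul_assoc, monomial_mul, one_mul, hγ]
    rw [this]
    exact Ideal.mul_mem_right _ _ (Ideal.mem_map_of_mem _
      ((hw _).2 (Ideal.subset_span ⟨i, hi, rfl⟩)))

/-- The primes coming from two distinct sets of variables are all distinct. -/
theorem injective_span_choiceSet {V W : Set σ} (hVW : V ≠ W) :
    Function.Injective (Sum.elim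
      (fun j : ∀ i : V, Fin (v i) =>
        Ideal.span (X '' choiceSet j : Set (MvPolynomial (Σ i : σ, Fin (v i)) k)))
      (fun j : ∀ i : W, Fin (v i) => Ideal.span (X '' choiceSet j))) := by
  have hset : ∀ s t : Set (Σ i : σ, Fin (v i)),
      Ideal.span (X '' s : Set (MvPolynomial (Σ i : σ, Fin (v i)) k)) = Ideal.span (X '' t) →
        s = t := by
    intro s t h
    ext p
    rw [← X_mem_span_X_image (k := k), h, X_mem_span_X_image]
  have hinj : ∀ {V : Set σ} (j j' : ∀ i : V, Fin (v i)), choiceSet j = choiceSet j' → j = j' := by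
    intro V j j' h
    funext ⟨i, hi⟩
    rw [← mem_choiceSet hi, ← h]
    exact (mem_choiceSet hi).2 rfl
  have himage : ∀ {V : Set σ} (j : ∀ i : V, Fin (v i)), Sigma.fst '' choiceSet j = V := by
    intro V j
    ext i
    constructor
    · rintro ⟨p, hp, rfl⟩
      exact fst_mem_of_mem_choiceSet hp
    · exact fun hi => ⟨_, (mem_choiceSet hi).2 rfl, rfl⟩
  rintro (j | j) (j' | j') h
  · exact congrArg Sum.inl (hinj _ _ (hset _ _ h))
  · exact absurd ((himage j).symm.trans ((congrArg _ (hset _ _ h)).trans (himage j'))) hVW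
  · exact absurd ((himage j').symm.trans ((congrArg _ (hset _ _ h).symm).trans (himage j))) hVW
  · exact congrArg Sum.inr (hinj _ _ (hset _ _ h))

theorem card_le_encard_embeddedPrimes {M : Type*} [AddCommMonoid M] [IsCancelAdd M] [UniqueSums M]
    [Finite σ] (z : ∀ i, Fin (v i)) {d : σ → M} {V W : Finset σ} (hVW : V ≠ W)
    (hV : V.Nonempty) (hW : W.Nonempty) {f g : MvPolynomial σ k}
    (hf : ∀ p, p * f ∈ toricIdeal k d ^ 2 ↔
      p ∈ Ideal.span (X '' (V : Set σ) : Set (MvPolynomial σ k)))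
    (hg : ∀ p, p * g ∈ toricIdeal k d ^ 2 ↔
      p ∈ Ideal.span (X '' (W : Set σ) : Set (MvPolynomial σ k))) :
    ((∏ i ∈ V, v i + ∏ i ∈ W, v i : ℕ) : ℕ∞) ≤
      (embeddedPrimes ((toricIdeal k d).map (split k v) ^ 2)).encard := by
  classical
  have hVW' : (V : Set σ) ≠ W := fun h => hVW (Finset.coe_injective h)
  have hcard : (∏ i ∈ V, v i + ∏ i ∈ W, v i : ℕ) = Nat.card
      ((∀ i : (V : Set σ), Fin (v i)) ⊕ (∀ i : (W : Set σ), Fin (v i))) := by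
    rw [Nat.card_sum, Nat.card_pi, Nat.card_pi]
    simp only [Nat.card_fin]
    rw [← Finset.prod_coe_sort V, ← Finset.prod_coe_sort W]
    rfl
  have hmem : ∀ (U : Finset σ), U.Nonempty → ∀ h : MvPolynomial σ k,
      (∀ p, p * h ∈ toricIdeal k d ^ 2 ↔
        p ∈ Ideal.span (X '' (U : Set σ) : Set (MvPolynomial σ k))) →
      ∀ j : ∀ i : (U : Set σ), Fin (v i),
        Ideal.span (X '' choiceSet j : Set (MvPolynomial (Σ i : σ, Fin (v i)) k)) ∈
          embeddedPrimes ((toricIdeal k d).map (split k v) ^ 2) := by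
    rintro U ⟨i, hi⟩ h hh j
    refine mem_embeddedPrimes_sq (map_split_toricIdeal_isPrime z d) ?_ fun hle => ?_
    · rw [← Ideal.map_pow]
      exact span_choiceSet_mem_associatedPrimes z hh j
    · have h1 := hle (X_mem_span_X_image.2 ((mem_choiceSet (j := j) hi).2 rfl))
      rw [map_split_toricIdeal z] at h1
      exact X_notMem_toricIdeal _ _ h1
  rw [hcard, ← ENat.card_eq_coe_natCard]
  rw [← Set.encard_univ, ← (injective_span_choiceSet (k := k) hVW').encard_image]
  refine Set.encard_le_encard ?_
  rintro _ ⟨j | j, -, rfl⟩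
  · exact hmem V hV f hf j
  · exact hmem W hW g hg j

end SplitAssociated

/-! ### The two witnesses and their multiples in the square -/

section Relations

variable {R : Type*} [CommRing R] {P : Ideal R}

theorem mul_mul_mem_sq {x y : R} (hx : x ∈ P) (hy : y ∈ P) (r : R) : r * (x * y) ∈ P ^ 2 := by
  rw [pow_two]
  exact Ideal.mul_mem_left _ _ (Ideal.mul_mem_mul hx hy)

/-- The element whose products with all variables except the `c_j` lie in `P ^ 2`. -/
def witnessNoC {R : Type*} [CommRing R] (a b z₂ z₃ z₄ z₅ t : R) : R :=
  z₂ * z₅ * t - z₃ * z₄ * t - b ^ 4 * z₅ - a ^ 4 * z₂ + a * b ^ 3 * z₄ + a ^ 3 * b * z₃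

/-- The element whose products with all variables lie in `P ^ 2`. -/
def witnessAll {R : Type*} [CommRing R] (a b z₂ z₃ z₄ t : R) : R :=
  b * z₂ * z₄ * t - a * z₃ ^ 2 * t - b ^ 5 * z₄ + 2 * a ^ 2 * b ^ 3 * z₃ - a ^ 3 * b ^ 2 * z₂

variable {a b c u z₂ z₃ z₄ z₅ t : R}

/-- The witness is `(z₂t - b⁴)(z₅t - a⁴) - (z₃t - ab³)(z₄t - a³b)` divided by `t`: the terms free of
`t` cancel. Each other multiple is likewise a combination of products of two relations. -/
theorem mul_witnessNoC_mem (h₂ : z₂ * t - b ^ 4 ∈ P) (h₃ : z₃ * t - a * b ^ 3 ∈ P)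
    (h₄ : z₄ * t - a ^ 3 * b ∈ P) (h₅ : z₅ * t - a ^ 4 ∈ P) (h₂₃ : b * z₃ - a * z₂ ∈ P)
    (h₄₅ : b * z₅ - a * z₄ ∈ P) (h₃₄ : b ^ 2 * z₄ - a ^ 2 * z₃ ∈ P)
    (hz : z₃ * z₄ - z₂ * z₅ ∈ P) :
    a * witnessNoC a b z₂ z₃ z₄ z₅ t ∈ P ^ 2 ∧ b * witnessNoC a b z₂ z₃ z₄ z₅ t ∈ P ^ 2 ∧
    z₂ * witnessNoC a b z₂ z₃ z₄ z₅ t ∈ P ^ 2 ∧ z₃ * witnessNoC a b z₂ z₃ z₄ z₅ t ∈ P ^ 2 ∧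
    z₄ * witnessNoC a b z₂ z₃ z₄ z₅ t ∈ P ^ 2 ∧ z₅ * witnessNoC a b z₂ z₃ z₄ z₅ t ∈ P ^ 2 ∧
    t * witnessNoC a b z₂ z₃ z₄ z₅ t ∈ P ^ 2 := by
  refine ⟨?_, ?_, ?_, ?_, ?_, ?_, ?_⟩
  · convert add_mem (mul_mul_mem_sq h₂₃ h₅ (-1)) (mul_mul_mem_sq h₃ h₄₅ 1) using 1
    rw [witnessNoC]; ring
  · convert add_mem (mul_mul_mem_sq h₂₃ h₄ (-1)) (mul_mul_mem_sq h₂ h₄₅ 1) using 1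
    rw [witnessNoC]; ring
  · convert add_mem (add_mem (mul_mul_mem_sq h₂ hz (-1)) (mul_mul_mem_sq h₂₃ h₃₄ (-b)))
      (mul_mul_mem_sq h₂₃ h₂₃ (-a ^ 2)) using 1
    rw [witnessNoC]; ring
  · convert add_mem (add_mem (mul_mul_mem_sq h₃ hz (-1)) (mul_mul_mem_sq h₂₃ h₃₄ (-a)))
      (mul_mul_mem_sq h₂₃ h₄₅ (-b ^ 2)) using 1
    rw [witnessNoC]; ring
  · convert add_mem (add_mem (mul_mul_mem_sq h₄ hz (-1)) (mul_mul_mem_sq h₄₅ h₃₄ (-b)))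
      (mul_mul_mem_sq h₂₃ h₄₅ (-a ^ 2)) using 1
    rw [witnessNoC]; ring
  · convert add_mem (add_mem (mul_mul_mem_sq h₅ hz (-1)) (mul_mul_mem_sq h₄₅ h₃₄ (-a)))
      (mul_mul_mem_sq h₄₅ h₄₅ (-b ^ 2)) using 1
    rw [witnessNoC]; ring
  · convert add_mem (mul_mul_mem_sq h₃ h₄ (-1)) (mul_mul_mem_sq h₂ h₅ 1) using 1
    rw [witnessNoC]; ring

/-- The witness is `b(z₂t - b⁴)(z₄t - a³b) - a(z₃t - ab³)²` divided by `t`. -/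
theorem mul_witnessAll_mem (h₂ : z₂ * t - b ^ 4 ∈ P) (h₃ : z₃ * t - a * b ^ 3 ∈ P)
    (h₄ : z₄ * t - a ^ 3 * b ∈ P) (h₂₃ : b * z₃ - a * z₂ ∈ P)
    (h₄₅ : b * z₅ - a * z₄ ∈ P) (h₃₄ : b ^ 2 * z₄ - a ^ 2 * z₃ ∈ P)
    (hz : z₃ * z₄ - z₂ * z₅ ∈ P) (hz₂₄ : b * (z₂ * z₄) - a * z₃ ^ 2 ∈ P)
    (hz₃₅ : b * z₄ ^ 2 - a * (z₃ * z₅) ∈ P) :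
    a * witnessAll a b z₂ z₃ z₄ t ∈ P ^ 2 ∧ b * witnessAll a b z₂ z₃ z₄ t ∈ P ^ 2 ∧
    z₂ * witnessAll a b z₂ z₃ z₄ t ∈ P ^ 2 ∧ z₃ * witnessAll a b z₂ z₃ z₄ t ∈ P ^ 2 ∧
    z₄ * witnessAll a b z₂ z₃ z₄ t ∈ P ^ 2 ∧ z₅ * witnessAll a b z₂ z₃ z₄ t ∈ P ^ 2 ∧
    t * witnessAll a b z₂ z₃ z₄ t ∈ P ^ 2 := by
  refine ⟨?_, ?_, ?_, ?_, ?_, ?_, ?_⟩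
  · convert add_mem (mul_mul_mem_sq h₂₃ h₄ (-b)) (mul_mul_mem_sq h₃ h₃₄ 1) using 1
    rw [witnessAll]; ring
  · convert add_mem (mul_mul_mem_sq h₃ h₂₃ (-a)) (mul_mul_mem_sq h₂ h₃₄ 1) using 1
    rw [witnessAll]; ring
  · convert add_mem (mul_mul_mem_sq h₂₃ h₂₃ (-a * b ^ 2)) (mul_mul_mem_sq h₂ hz₂₄ 1) using 1
    rw [witnessAll]; ring
  · convert add_mem (mul_mul_mem_sq h₂₃ h₃₄ (-b ^ 2)) (mul_mul_mem_sq h₃ hz₂₄ 1) using 1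
    rw [witnessAll]; ring
  · convert add_mem (mul_mul_mem_sq h₃₄ h₃₄ (-b)) (mul_mul_mem_sq h₄ hz₂₄ 1) using 1
    rw [witnessAll]; ring
  · convert add_mem (add_mem (mul_mul_mem_sq h₃ hz₃₅ 1) (mul_mul_mem_sq h₄₅ h₃₄ (-b ^ 2)))
      (mul_mul_mem_sq h₄ hz (-b)) using 1
    rw [witnessAll]; ring
  · convert add_mem (mul_mul_mem_sq h₃ h₃ (-a)) (mul_mul_mem_sq h₂ h₄ b) using 1
    rw [witnessAll]; ring

theorem mul_witness_mem (h₂ : z₂ * t - b ^ 4 ∈ P) (h₃ : z₃ * t - a * b ^ 3 ∈ P)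
    (h₄ : z₄ * t - a ^ 3 * b ∈ P) (h₂₃ : b * z₃ - a * z₂ ∈ P)
    (h₃₄ : b ^ 2 * z₄ - a ^ 2 * z₃ ∈ P) (h₁ : u * t - a ^ 2 * b ^ 2 * c ∈ P)
    (h₁₃ : b * u - a * c * z₃ ∈ P) (h₁₄ : b * c * z₄ - a * u ∈ P)
    (hu₃ : u * z₃ - c * (z₂ * z₄) ∈ P) (hu₅ : u * z₅ - c * z₄ ^ 2 ∈ P) :
    u * witnessNoC a b z₂ z₃ z₄ z₅ t ∈ P ^ 2 ∧ c * witnessAll a b z₂ z₃ z₄ t ∈ P ^ 2 ∧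
    u * witnessAll a b z₂ z₃ z₄ t ∈ P ^ 2 := by
  refine ⟨?_, ?_, ?_⟩
  · convert add_mem (add_mem (add_mem (mul_mul_mem_sq h₂₃ h₁₄ (-a ^ 2)) (mul_mul_mem_sq h₂ hu₅ 1))
      (mul_mul_mem_sq h₁₄ h₃₄ (-b))) (mul_mul_mem_sq h₄ hu₃ (-1)) using 1
    rw [witnessNoC]; ring
  · convert add_mem (add_mem (mul_mul_mem_sq h₂ h₁₄ 1) (mul_mul_mem_sq h₂₃ h₁ (-1)))
      (mul_mul_mem_sq h₃ h₁₃ 1) using 1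
    rw [witnessAll]; ring
  · convert add_mem (add_mem (mul_mul_mem_sq h₂ h₁₃ z₄) (mul_mul_mem_sq h₂₃ h₁₄ (-a * b ^ 2)))
      (mul_mul_mem_sq h₃ hu₃ (-a)) using 1
    rw [witnessAll]; ring

end Relations

/-! ### Degrees in the spread ring and the two colon ideals -/

section Spread

variable {k : Type*} [Field k] {n : ℕ}

theorem weight_spreadDegree (μ : UVar n →₀ ℕ) :
    Finsupp.weight (spreadDegree n) μ =
      ((((∑ j, μ (.U j) + μ (.Z 0) + μ (.Z 1) + μ (.Z 2) + μ (.Z 3) : ℕ) : ℤ) - μ .T,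
        Finsupp.single 0 (μ .a + 2 * ∑ j, μ (.U j) + μ (.Z 1) + 3 * μ (.Z 2) + 4 * μ (.Z 3)) +
        Finsupp.single 1 (μ .b + 2 * ∑ j, μ (.U j) + 4 * μ (.Z 0) + 3 * μ (.Z 1) + μ (.Z 2)) +
        Finsupp.single 2 (∑ j, (μ (.c j) + μ (.U j)))), fun j => μ (.c j) + μ (.U j)) := by
  classical
  induction μ using Finsupp.induction_linear with
  | zero => simp; rfl
  | add f g hf hg =>
    rw [map_add, hf, hg]
    simp only [Finsupp.add_apply, Finset.sum_add_distrib]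
    refine Prod.ext (Prod.ext ?_ ?_) ?_
    · push_cast; simp only [Prod.fst_add]; ring
    · ext i
      fin_cases i <;> simp <;> ring
    · funext j
      simp
      ring
  | single x e =>
    rw [Finsupp.weight_single]
    cases x with
    | Z i =>
      refine Prod.ext (Prod.ext ?_ ?_) ?_
      · fin_cases i <;> simp [spreadDegree, reesDegree, UVar.toZVar]
      · ext l
        fin_cases i <;> fin_cases l <;>
          simp [spreadDegree, reesDegree, UVar.toZVar] <;> ring
      · funext j
        simp [spreadDegree, weight]
    | _ =>
      refine Prod.ext (Prod.ext ?_ ?_) ?_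
      · simp [spreadDegree, reesDegree, UVar.toZVar, Finsupp.single_apply]
      · ext l
        fin_cases l <;>
          simp [spreadDegree, reesDegree, UVar.toZVar, Finsupp.single_apply] <;> ring
      · funext j
        simp [spreadDegree, weight, Finsupp.single_apply, Pi.single_apply, eq_comm]

end Spread

section Colon

variable {k : Type*} [Field k] {n : ℕ}

/-- The `t`-degree equation is rearranged to live in `ℕ`; the total `c`-degree is dropped, being the
sum of the last family of equations. -/
theorem weight_spreadDegree_eq {μ ν : UVar n →₀ ℕ}
    (h : Finsupp.weight (spreadDegree n) μ = Finsupp.weight (spreadDegree n) ν) :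
    (∑ j, μ (.U j) + μ (.Z 0) + μ (.Z 1) + μ (.Z 2) + μ (.Z 3)) + ν .T =
      (∑ j, ν (.U j) + ν (.Z 0) + ν (.Z 1) + ν (.Z 2) + ν (.Z 3)) + μ .T ∧
    μ .a + 2 * ∑ j, μ (.U j) + μ (.Z 1) + 3 * μ (.Z 2) + 4 * μ (.Z 3) =
      ν .a + 2 * ∑ j, ν (.U j) + ν (.Z 1) + 3 * ν (.Z 2) + 4 * ν (.Z 3) ∧
    μ .b + 2 * ∑ j, μ (.U j) + 4 * μ (.Z 0) + 3 * μ (.Z 1) + μ (.Z 2) =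
      ν .b + 2 * ∑ j, ν (.U j) + 4 * ν (.Z 0) + 3 * ν (.Z 1) + ν (.Z 2) ∧
    ∀ j, μ (.c j) + μ (.U j) = ν (.c j) + ν (.U j) := by
  rw [weight_spreadDegree, weight_spreadDegree] at h
  have h1 := congrArg (fun x => x.1.1) h
  have h2 := congrArg (fun x => x.1.2 0) h
  have h3 := congrArg (fun x => x.1.2 1) h
  have h4 := congrArg (fun x => x.2) h
  simp only [Finsupp.add_apply, Finsupp.single_apply] at h1 h2 h3 h4
  refine ⟨by omega, by simpa using h2, by simpa using h3, fun j => congrFun h4 j⟩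

theorem ext_of_eq {μ ν : UVar n →₀ ℕ} (ha : μ .a = ν .a) (hb : μ .b = ν .b)
    (hc : ∀ j, μ (.c j) = ν (.c j)) (hU : ∀ j, μ (.U j) = ν (.U j))
    (h0 : μ (.Z 0) = ν (.Z 0)) (h1 : μ (.Z 1) = ν (.Z 1)) (h2 : μ (.Z 2) = ν (.Z 2))
    (h3 : μ (.Z 3) = ν (.Z 3)) (hT : μ .T = ν .T) : μ = ν := by
  ext x
  cases x with
  | a => exact ha
  | b => exact hb
  | c j => exact hc j
  | U j => exact hU j
  | Z i => fin_cases i <;> assumption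
  | T => exact hT

theorem isolated_of_sum_le_one {μ : UVar n →₀ ℕ} (ha : μ .a = 0) (hb : μ .b = 0)
    (hU : ∀ j, μ (.U j) = 0) (h1 : μ (.Z 1) = 0) (h2 : μ (.Z 2) = 0)
    (h : μ (.Z 0) + μ (.Z 3) + μ .T ≤ 1) : Isolated (spreadDegree n) μ := by
  intro ν hν
  obtain ⟨e1, e2, e3, e4⟩ := weight_spreadDegree_eq hν
  have hs : ∑ j, μ (.U j) = 0 := Finset.sum_eq_zero fun j _ => hU j
  -- `Z 0` and `Z 3` do not both occur in `μ`, so its `a`-degree or its `b`-degree is zero, while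
  -- each `U j` contributes 2 to both.
  have hsν : ∑ j, ν (.U j) = 0 := by omega
  have hUν : ∀ j, ν (.U j) = 0 := fun j =>
    Finset.sum_eq_zero_iff.1 hsν j (Finset.mem_univ j)
  refine ext_of_eq ?_ ?_ (fun j => ?_) (fun j => by rw [hU, hUν]) ?_ ?_ ?_ ?_ ?_
  · omega
  · omega
  · have := e4 j
    rw [hU, hUν] at this
    exact this
  all_goals omega

/-- Without `c_j` no `U_j` can occur; `a`-degree at most 2 excludes `Z 2` and `Z 3`, and `b`-degree
at most 3 excludes `Z 0`. The `c_j` must be excluded, since `b U_j` and `a c_j Z₃` have the same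
degree. -/
theorem isolated_of_le_one {μ : UVar n →₀ ℕ} (ha : μ .a ≤ 1) (hb : μ .b = 0)
    (hc : ∀ j, μ (.c j) = 0) (hU : ∀ j, μ (.U j) = 0) (h0 : μ (.Z 0) = 0) (h2 : μ (.Z 2) = 0)
    (h3 : μ (.Z 3) = 0) (h : μ (.Z 1) + μ .T ≤ 1) : Isolated (spreadDegree n) μ := by
  intro ν hν
  obtain ⟨e1, e2, e3, e4⟩ := weight_spreadDegree_eq hν
  have hs : ∑ j, μ (.U j) = 0 := Finset.sum_eq_zero fun j _ => hU j
  have hUν : ∀ j, ν (.U j) = 0 := fun j => by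
    have := e4 j
    rw [hU, hc] at this
    omega
  have hsν : ∑ j, ν (.U j) = 0 := Finset.sum_eq_zero fun j _ => hUν j
  have hz : μ (.Z 1) = 0 ∨ μ (.Z 1) = 1 := by omega
  have hν2 : ν (.Z 2) = 0 := by rcases hz with hz | hz <;> omega
  have hν3 : ν (.Z 3) = 0 := by omega
  have hν0 : ν (.Z 0) = 0 := by omega
  have hν1 : ν (.Z 1) = μ (.Z 1) := by rcases hz with hz | hz <;> omega
  refine ext_of_eq ?_ ?_ (fun j => ?_) (fun j => by rw [hU, hUν]) ?_ ?_ ?_ ?_ ?_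
  · omega
  · omega
  · have := e4 j
    rw [hU, hUν] at this
    exact this
  all_goals omega

/-- The variable `X x`, with the coefficient field explicit. -/
abbrev uX (k : Type*) [Field k] {n : ℕ} (x : UVar n) : MvPolynomial (UVar n) k := X x

variable (n) in
theorem relations_mem :
    ((uX k (.Z 0) * uX k .T - uX k .b ^ 4 : MvPolynomial (UVar n) k) ∈ toricIdeal k (spreadDegree n)) ∧
    ((uX k (.Z 1) * uX k .T - uX k .a * uX k .b ^ 3 : MvPolynomial (UVar n) k) ∈
      toricIdeal k (spreadDegree n)) ∧
    ((uX k (.Z 2) * uX k .T - uX k .a ^ 3 * uX k .b : MvPolynomial (UVar n) k) ∈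
      toricIdeal k (spreadDegree n)) ∧
    ((uX k (.Z 3) * uX k .T - uX k .a ^ 4 : MvPolynomial (UVar n) k) ∈ toricIdeal k (spreadDegree n)) ∧
    ((uX k .b * uX k (.Z 1) - uX k .a * uX k (.Z 0) : MvPolynomial (UVar n) k) ∈
      toricIdeal k (spreadDegree n)) ∧
    ((uX k .b * uX k (.Z 3) - uX k .a * uX k (.Z 2) : MvPolynomial (UVar n) k) ∈
      toricIdeal k (spreadDegree n)) ∧
    ((uX k .b ^ 2 * uX k (.Z 2) - uX k .a ^ 2 * uX k (.Z 1) : MvPolynomial (UVar n) k) ∈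
      toricIdeal k (spreadDegree n)) ∧
    ((uX k (.Z 1) * uX k (.Z 2) - uX k (.Z 0) * uX k (.Z 3) : MvPolynomial (UVar n) k) ∈
      toricIdeal k (spreadDegree n)) ∧
    ((uX k .b * (uX k (.Z 0) * uX k (.Z 2)) - uX k .a * uX k (.Z 1) ^ 2 : MvPolynomial (UVar n) k) ∈
      toricIdeal k (spreadDegree n)) ∧
    ((uX k .b * uX k (.Z 2) ^ 2 - uX k .a * (uX k (.Z 1) * uX k (.Z 3)) : MvPolynomial (UVar n) k) ∈
      toricIdeal k (spreadDegree n)) := by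
  simp only [toricIdeal, RingHom.mem_ker, map_sub, map_mul, map_pow, toricHom_X,
    AddMonoidAlgebra.single_mul_single, AddMonoidAlgebra.single_pow, one_pow, mul_one, sub_eq_zero]
  refine ⟨?_, ?_, ?_, ?_, ?_, ?_, ?_, ?_, ?_, ?_⟩ <;>
  · congr 1
    refine Prod.ext (Prod.ext ?_ ?_) ?_
    · simp [spreadDegree, reesDegree, UVar.toZVar]
    · ext l
      fin_cases l <;> simp [spreadDegree, reesDegree, UVar.toZVar]
    · funext j
      simp [spreadDegree, weight]

theorem relations_U_mem (j : Fin n) :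
    ((uX k (.U j) * uX k .T - uX k .a ^ 2 * uX k .b ^ 2 * uX k (.c j) : MvPolynomial (UVar n) k) ∈
      toricIdeal k (spreadDegree n)) ∧
    ((uX k .b * uX k (.U j) - uX k .a * uX k (.c j) * uX k (.Z 1) : MvPolynomial (UVar n) k) ∈
      toricIdeal k (spreadDegree n)) ∧
    ((uX k .b * uX k (.c j) * uX k (.Z 2) - uX k .a * uX k (.U j) : MvPolynomial (UVar n) k) ∈
      toricIdeal k (spreadDegree n)) ∧
    ((uX k (.U j) * uX k (.Z 1) - uX k (.c j) * (uX k (.Z 0) * uX k (.Z 2)) : MvPolynomial (UVar n) k) ∈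
      toricIdeal k (spreadDegree n)) ∧
    ((uX k (.U j) * uX k (.Z 3) - uX k (.c j) * uX k (.Z 2) ^ 2 : MvPolynomial (UVar n) k) ∈
      toricIdeal k (spreadDegree n)) := by
  simp only [toricIdeal, RingHom.mem_ker, map_sub, map_mul, map_pow, toricHom_X,
    AddMonoidAlgebra.single_mul_single, AddMonoidAlgebra.single_pow, one_pow, mul_one, sub_eq_zero]
  refine ⟨?_, ?_, ?_, ?_, ?_⟩ <;>
  · congr 1
    refine Prod.ext (Prod.ext ?_ ?_) ?_
    · simp [spreadDegree, reesDegree, UVar.toZVar]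
    · ext l
      fin_cases l <;> simp [spreadDegree, reesDegree, UVar.toZVar]
    · funext j
      simp [spreadDegree, weight]

/-- If a monomial `γ` of `p` avoided `V`, the coefficient of `p * w` at `γ + μ` would be `r` times
that of `p` at `γ`, so nonzero, although it vanishes on `I`. -/
theorem mem_span_X_of_mul_mem {σ : Type*} {I : Ideal (MvPolynomial σ k)}
    {w p : MvPolynomial σ k} {V : Set σ} {μ : σ →₀ ℕ} {r : k} (hr : r ≠ 0)
    (hw : ∀ γ : σ →₀ ℕ, (∀ i ∈ V, γ i = 0) →
      coeff (γ + μ) (p * w) = coeff (γ + μ) (p * monomial μ r))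
    (hI : ∀ γ : σ →₀ ℕ, (∀ i ∈ V, γ i = 0) → ∀ f ∈ I, coeff (γ + μ) f = 0)
    (hp : p * w ∈ I) : p ∈ Ideal.span (X '' V : Set (MvPolynomial σ k)) := by
  rw [mem_ideal_span_X_image]
  intro γ hγ
  by_contra! hcon
  have h := hI γ hcon _ hp
  rw [hw γ hcon, coeff_mul_monomial] at h
  exact mem_support_iff.1 hγ ((mul_eq_zero.1 h).resolve_right hr)

theorem coeff_mul_X_mul_eq_zero {σ : Type*} {m : σ →₀ ℕ} {i : σ} (h : m i = 0)
    (p q : MvPolynomial σ k) : coeff m (p * (X i * q)) = 0 := by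
  classical
  rw [mul_left_comm, mul_comm, coeff_mul_X', if_neg (by simpa using h)]

theorem mul_witnessNoC_mem_iff (p : MvPolynomial (UVar n) k) :
    p * witnessNoC (uX k .a) (uX k .b) (uX k (.Z 0)) (uX k (.Z 1)) (uX k (.Z 2)) (uX k (.Z 3)) (uX k .T) ∈
      toricIdeal k (spreadDegree n) ^ 2 ↔
    p ∈ Ideal.span (X '' (Set.range UVar.c)ᶜ : Set (MvPolynomial (UVar n) k)) := by
  classical
  constructor
  · refine mem_span_X_of_mul_mem
      (μ := Finsupp.single (.Z 0) 1 + Finsupp.single (.Z 3) 1 + Finsupp.single .T 1)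
      one_ne_zero (fun γ hγ => ?_) fun γ hγ f hf => ?_
    · have ha := hγ .a (by simp)
      have hb := hγ .b (by simp)
      have h1 := hγ (.Z 1) (by simp)
      have hm : (monomial (Finsupp.single (.Z 0) 1 + Finsupp.single (.Z 3) 1 +
          Finsupp.single .T 1) 1 : MvPolynomial (UVar n) k) = uX k (.Z 0) * uX k (.Z 3) * uX k .T := by
        simp only [uX, X, monomial_mul, one_mul]
      -- Every term other than `Z₂ Z₅ T` is divisible by `Z₃`, `b` or `a`, none of which divides `γ
      -- + μ`.
      have hw : p * witnessNoC (uX k .a) (uX k .b) (uX k (.Z 0)) (uX k (.Z 1)) (uX k (.Z 2)) (uX k (.Z 3)) (uX k .T) =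
          p * monomial (Finsupp.single (.Z 0) 1 + Finsupp.single (.Z 3) 1 + Finsupp.single .T 1) 1 +
          p * (uX k (.Z 1) * (-uX k (.Z 2) * uX k .T)) + p * (uX k .b * (-uX k .b ^ 3 * uX k (.Z 3))) +
          p * (uX k .a * (uX k .b ^ 3 * uX k (.Z 2) + uX k .a ^ 2 * uX k .b * uX k (.Z 1) -
            uX k .a ^ 3 * uX k (.Z 0))) := by
        rw [witnessNoC, hm]
        ring
      rw [hw, coeff_add, coeff_add, coeff_add, coeff_mul_X_mul_eq_zero (by simp [h1]),
        coeff_mul_X_mul_eq_zero (by simp [hb]), coeff_mul_X_mul_eq_zero (by simp [ha]),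
        add_zero, add_zero, add_zero]
    · refine coeff_eq_zero_of_mem_toricIdeal_sq (fun α β hαβ => ?_) hf
      have h : ∀ x, α x + β x = γ x + (Finsupp.single (.Z 0) 1 + Finsupp.single (.Z 3) 1 +
          Finsupp.single .T 1 : UVar n →₀ ℕ) x := fun x => DFunLike.congr_fun hαβ x
      have ha := h .a
      have hb := h .b
      have hU := fun j => h (.U j)
      have h0 := h (.Z 0)
      have h1 := h (.Z 1)
      have h2 := h (.Z 2)
      have h3 := h (.Z 3)
      have hT := h .T
      have hγU : ∀ j, γ (.U j) = 0 := fun j => hγ _ (by simp)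
      rw [hγ _ (by simp)] at ha hb h0 h1 h2 h3 hT
      simp [hγU] at ha hb hU h0 h1 h2 h3 hT
      -- The three variables `Z₂`, `Z₅`, `T` are shared between the factors, so one factor gets at
      -- most one of them, times a `c`-monomial.
      by_cases hα : α (.Z 0) + α (.Z 3) + α .T ≤ 1
      · exact .inl (isolated_of_sum_le_one ha.1 hb.1 (fun j => (hU j).1) h1.1 h2.1 hα)
      · exact .inr (isolated_of_sum_le_one ha.2 hb.2 (fun j => (hU j).2) h1.2 h2.2 (by omega))
  · intro hp
    suffices h : Ideal.span (X '' (Set.range UVar.c)ᶜ : Set (MvPolynomial (UVar n) k)) ≤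
        (toricIdeal k (spreadDegree n) ^ 2).colon ({witnessNoC (uX k .a) (uX k .b) (uX k (.Z 0)) (uX k (.Z 1))
          (uX k (.Z 2)) (uX k (.Z 3)) (uX k .T)} : Set _) from Submodule.mem_colon_singleton.1 (h hp)
    rw [Ideal.span_le]
    rintro _ ⟨x, hx, rfl⟩
    rw [SetLike.mem_coe, Submodule.mem_colon_singleton, smul_eq_mul]
    obtain ⟨h2, h3, h4, h5, h23, h45, h34, hz, h24, h35⟩ := relations_mem (k := k) n
    obtain ⟨r1, r2, r3, r4, r5, r6, r7⟩ := mul_witnessNoC_mem h2 h3 h4 h5 h23 h45 h34 hz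
    cases x with
    | a => exact r1
    | b => exact r2
    | c j => exact absurd ⟨j, rfl⟩ hx
    | U j =>
      obtain ⟨u1, u2, u3, u4, u5⟩ := relations_U_mem (k := k) j
      exact (mul_witness_mem h2 h3 h4 h23 h34 u1 u2 u3 u4 u5).1
    | Z i =>
      fin_cases i
      exacts [r3, r4, r5, r6]
    | T => exact r7

theorem mul_witnessAll_mem_iff (p : MvPolynomial (UVar n) k) :
    p * witnessAll (uX k .a) (uX k .b) (uX k (.Z 0)) (uX k (.Z 1)) (uX k (.Z 2)) (uX k .T) ∈
      toricIdeal k (spreadDegree n) ^ 2 ↔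
    p ∈ Ideal.span (X '' Set.univ : Set (MvPolynomial (UVar n) k)) := by
  classical
  constructor
  · refine mem_span_X_of_mul_mem
      -- The term `-a Z₃² T` is the only one not divisible by `b`, and its coefficient is nonzero in
      -- every characteristic.
      (μ := Finsupp.single .a 1 + Finsupp.single (.Z 1) 2 + Finsupp.single .T 1)
      (neg_ne_zero.2 one_ne_zero) (fun γ hγ => ?_) fun γ hγ f hf => ?_
    · have hb := hγ .b (by simp)
      have hm : (monomial (Finsupp.single .a 1 + Finsupp.single (.Z 1) 2 +
          Finsupp.single .T 1) (-1) : MvPolynomial (UVar n) k) = -(uX k .a * uX k (.Z 1) ^ 2 * uX k .T) := by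
        simp only [uX, X, monomial_mul, monomial_pow, one_mul, one_pow, map_neg]
        simp
      have hw : p * witnessAll (uX k .a) (uX k .b) (uX k (.Z 0)) (uX k (.Z 1)) (uX k (.Z 2)) (uX k .T) =
          p * monomial (Finsupp.single .a 1 + Finsupp.single (.Z 1) 2 + Finsupp.single .T 1) (-1) +
          p * (uX k .b * (uX k (.Z 0) * uX k (.Z 2) * uX k .T - uX k .b ^ 4 * uX k (.Z 2) +
            2 * uX k .a ^ 2 * uX k .b ^ 2 * uX k (.Z 1) - uX k .a ^ 3 * uX k .b * uX k (.Z 0))) := by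
        rw [witnessAll, hm]
        ring
      rw [hw, coeff_add, coeff_mul_X_mul_eq_zero (by simp [hb]), add_zero]
    · refine coeff_eq_zero_of_mem_toricIdeal_sq (fun α β hαβ => ?_) hf
      have h : ∀ x, α x + β x = (Finsupp.single .a 1 + Finsupp.single (.Z 1) 2 +
          Finsupp.single .T 1 : UVar n →₀ ℕ) x := fun x => by
        have := DFunLike.congr_fun hαβ x
        rwa [Finsupp.add_apply, Finsupp.add_apply, hγ x trivial, zero_add] at this
      have ha := h .a
      have hb := h .b
      have hc := fun j => h (.c j)
      have hU := fun j => h (.U j)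
      have h0 := h (.Z 0)
      have h1 := h (.Z 1)
      have h2 := h (.Z 2)
      have h3 := h (.Z 3)
      have hT := h .T
      simp at ha hb hc hU h0 h1 h2 h3 hT
      -- `Z₃² T` has total degree 3, so one factor gets at most one of these variables.
      by_cases hα : α (.Z 1) + α .T ≤ 1
      · exact .inl (isolated_of_le_one (by omega) hb.1 (fun j => (hc j).1) (fun j => (hU j).1)
          h0.1 h2.1 h3.1 hα)
      · exact .inr (isolated_of_le_one (by omega) hb.2 (fun j => (hc j).2) (fun j => (hU j).2)
          h0.2 h2.2 h3.2 (by omega))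
  · intro hp
    suffices h : Ideal.span (X '' Set.univ : Set (MvPolynomial (UVar n) k)) ≤
        (toricIdeal k (spreadDegree n) ^ 2).colon ({witnessAll (uX k .a) (uX k .b) (uX k (.Z 0)) (uX k (.Z 1))
          (uX k (.Z 2)) (uX k .T)} : Set _) from Submodule.mem_colon_singleton.1 (h hp)
    rw [Ideal.span_le]
    rintro _ ⟨x, -, rfl⟩
    rw [SetLike.mem_coe, Submodule.mem_colon_singleton, smul_eq_mul]
    obtain ⟨h2, h3, h4, h5, h23, h45, h34, hz, h24, h35⟩ := relations_mem (k := k) n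
    obtain ⟨r1, r2, r3, r4, r5, r6, r7⟩ := mul_witnessAll_mem h2 h3 h4 h23 h45 h34 hz h24 h35
    cases x with
    | a => exact r1
    | b => exact r2
    | c j =>
      obtain ⟨u1, u2, u3, u4, u5⟩ := relations_U_mem (k := k) j
      obtain ⟨-, w, -⟩ := mul_witness_mem h2 h3 h4 h23 h34 u1 u2 u3 u4 u5
      exact w
    | U j =>
      obtain ⟨u1, u2, u3, u4, u5⟩ := relations_U_mem (k := k) j
      obtain ⟨-, -, w⟩ := mul_witness_mem h2 h3 h4 h23 h34 u1 u2 u3 u4 u5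
      exact w
    | Z i =>
      fin_cases i
      exacts [r3, r4, r5, r6]
    | T => exact r7

end Colon

/-! ### Renaming variables by their positions; data for the height -/

section Transport

variable {k σ τ M : Type*} [Field k] [AddCommMonoid M]

theorem weight_mapDomain (f : σ → τ) (d : τ → M) (μ : σ →₀ ℕ) :
    Finsupp.weight d (μ.mapDomain f) = Finsupp.weight (d ∘ f) μ := by
  rw [Finsupp.weight_apply, Finsupp.weight_apply, Finsupp.sum_mapDomain_index]
  · rfl
  · simp
  · intros; rw [add_smul]

theorem colon_rename (e : σ ≃ τ) {d : σ → M} {w : MvPolynomial σ k} {V : Set σ}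
    (h : ∀ p, p * w ∈ toricIdeal k d ^ 2 ↔ p ∈ Ideal.span (X '' V : Set (MvPolynomial σ k)))
    (p : MvPolynomial τ k) :
    p * rename e w ∈ toricIdeal k (d ∘ e.symm) ^ 2 ↔
      p ∈ Ideal.span (X '' (e '' V) : Set (MvPolynomial τ k)) := by
  let E := (renameEquiv k e).toRingEquiv
  have hE : ∀ q : MvPolynomial σ k, E q = rename e q := fun _ => rfl
  have hmap : ∀ I : Ideal (MvPolynomial σ k),
      I.map (rename e : MvPolynomial σ k →ₐ[k] MvPolynomial τ k) = I.map E := fun _ => rfl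
  have hmem : ∀ (I : Ideal (MvPolynomial σ k)) q, E q ∈ I.map E ↔ q ∈ I := fun I q => by
    rw [Ideal.mem_map_of_equiv]
    exact ⟨fun ⟨x, hx, h⟩ => E.injective h ▸ hx, fun h => ⟨q, h, rfl⟩⟩
  obtain ⟨q, rfl⟩ := E.surjective p
  have hspan : Ideal.span (X '' (e '' V) : Set (MvPolynomial τ k)) =
      (Ideal.span (X '' V : Set (MvPolynomial σ k))).map E := by
    rw [Ideal.map_span, Set.image_image, Set.image_image]
    congr 1
    refine Set.image_congr fun i _ => ?_
    exact (rename_X e i).symm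
  rw [hspan, hmem, ← h q, ← toricIdeal_map_rename, hmap, ← Ideal.map_pow, ← hE, ← map_mul, hmem]

end Transport

section Positions

variable {n : ℕ}

/-- The positions of the variables as an equivalence. -/
def UVar.posEquiv (n : ℕ) : UVar n ≃ Fin (2 * n + 7) :=
  Equiv.ofBijective UVar.pos <| by
    constructor
    · intro x y h
      have h := congrArg Fin.val h
      cases x <;> cases y <;> simp only [UVar.pos] at h <;>
        first | rfl | omega | (congr 1; ext; omega)
    · rintro ⟨i, hi⟩
      by_cases h0 : i = 0
      · exact ⟨.a, Fin.ext h0.symm⟩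
      by_cases h1 : i = 1
      · exact ⟨.b, Fin.ext h1.symm⟩
      by_cases h2 : i < n + 2
      · exact ⟨.c ⟨i - 2, by omega⟩, Fin.ext (by simp only [UVar.pos]; omega)⟩
      by_cases h3 : i < 2 * n + 2
      · exact ⟨.U ⟨i - (n + 2), by omega⟩, Fin.ext (by simp only [UVar.pos]; omega)⟩
      by_cases h4 : i < 2 * n + 6
      · exact ⟨.Z ⟨i - (2 * n + 2), by omega⟩, Fin.ext (by simp only [UVar.pos]; omega)⟩
      · exact ⟨.T, Fin.ext (by simp only [UVar.pos]; omega)⟩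

theorem UVar.posEquiv_apply (x : UVar n) : UVar.posEquiv n x = x.pos := rfl

theorem image_pos_compl_range_c :
    UVar.posEquiv n '' (Set.range UVar.c)ᶜ =
      ((Finset.univ.filter fun i : Fin (2 * n + 7) => (i : ℕ) < 2 ∨ n + 2 ≤ (i : ℕ) :
        Finset (Fin (2 * n + 7))) : Set (Fin (2 * n + 7))) := by
  ext i
  obtain ⟨x, rfl⟩ := (UVar.posEquiv n).surjective i
  rw [(UVar.posEquiv n).injective.mem_set_image]
  cases x <;> simp [UVar.posEquiv_apply, UVar.pos] <;> omega

theorem prod_filter_eq (v : Fin (2 * n + 7) → ℕ) {i₀ i₁ : Fin (2 * n + 7)}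
    (h₀ : (i₀ : ℕ) = 0) (h₁ : (i₁ : ℕ) = 1) :
    ∏ i ∈ Finset.univ.filter (fun i : Fin (2 * n + 7) => (i : ℕ) < 2 ∨ n + 2 ≤ (i : ℕ)), v i =
      v i₀ * v i₁ *
        ∏ i ∈ Finset.univ.filter (fun i : Fin (2 * n + 7) => n + 2 ≤ (i : ℕ)), v i := by
  classical
  have h : Finset.univ.filter (fun i : Fin (2 * n + 7) => (i : ℕ) < 2 ∨ n + 2 ≤ (i : ℕ)) =
      insert i₀ (insert i₁
        (Finset.univ.filter fun i : Fin (2 * n + 7) => n + 2 ≤ (i : ℕ))) := by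
    ext i
    simp only [Finset.mem_filter, Finset.mem_univ, true_and, Finset.mem_insert, Fin.ext_iff]
    omega
  rw [h, Finset.prod_insert (by simp [Fin.ext_iff, h₀, h₁]),
    Finset.prod_insert (by simp [h₁]), mul_assoc]

theorem card_filter_eq :
    (Finset.univ.filter (fun i : Fin (2 * n + 7) => n + 2 ≤ (i : ℕ))).card = n + 5 := by
  have h : Finset.univ.filter (fun i : Fin (2 * n + 7) => n + 2 ≤ (i : ℕ)) =
      Finset.Ici ⟨n + 2, by omega⟩ := by
    ext i
    simp [Fin.le_def]
  rw [h, Fin.card_Ici]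
  simp only
  omega

/-- The variables `U_j` and `Z_i`. -/
def relVar (n : ℕ) : Fin n ⊕ Fin 4 → UVar n := Sum.elim UVar.U UVar.Z

/-- The monomial in `a, b, c_j` equal to `T` times the given variable `U_j` or `Z_i` in the
extended Rees algebra. -/
def relExp : UVar n → UVar n →₀ ℕ
  | .U j => Finsupp.single .a 2 + Finsupp.single .b 2 + Finsupp.single (.c j) 1
  | .Z i => ![Finsupp.single .b 4, Finsupp.single .a 1 + Finsupp.single .b 3,
      Finsupp.single .a 3 + Finsupp.single .b 1, Finsupp.single .a 4] i
  | _ => 0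

theorem relVar_injective : Function.Injective (relVar n) := by
  rintro (i | i) (j | j) h <;> simp [relVar] at h ⊢ <;> exact h

theorem weight_relExp (s : Fin n ⊕ Fin 4) :
    Finsupp.weight (spreadDegree n) (relExp (relVar n s)) =
      spreadDegree n (relVar n s) + spreadDegree n .T := by
  rcases s with j | i
  · refine Prod.ext (Prod.ext ?_ ?_) ?_
    · simp [relExp, relVar, Finsupp.weight_single, spreadDegree, reesDegree, UVar.toZVar]
    · ext l
      fin_cases l <;>
        simp [relExp, relVar, Finsupp.weight_single, spreadDegree, reesDegree, UVar.toZVar]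
    · funext j
      simp [relExp, relVar, Finsupp.weight_single, spreadDegree, weight]
  · refine Prod.ext (Prod.ext ?_ ?_) ?_
    · fin_cases i <;>
        simp [relExp, relVar, Finsupp.weight_single, spreadDegree, reesDegree, UVar.toZVar]
    · ext l
      fin_cases i <;> fin_cases l <;>
        simp [relExp, relVar, Finsupp.weight_single, spreadDegree, reesDegree, UVar.toZVar]
    · funext j
      fin_cases i <;>
        simp [relExp, relVar, Finsupp.weight_single, spreadDegree, weight]

theorem relExp_relVar_apply (s s' : Fin n ⊕ Fin 4) : relExp (relVar n s) (relVar n s') = 0 := by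
  classical
  rcases s with j | i <;> rcases s' with j' | i' <;> simp [relExp, relVar]
  all_goals fin_cases i <;> simp

theorem eq_of_weight_eq {μ ν : UVar n →₀ ℕ} (hμ : ∀ s, μ (relVar n s) = 0)
    (hν : ∀ s, ν (relVar n s) = 0)
    (h : Finsupp.weight (spreadDegree n) μ = Finsupp.weight (spreadDegree n) ν) : μ = ν := by
  have hμU : ∀ j, μ (.U j) = 0 := fun j => hμ (.inl j)
  have hνU : ∀ j, ν (.U j) = 0 := fun j => hν (.inl j)
  have hμZ : ∀ i, μ (.Z i) = 0 := fun i => hμ (.inr i)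
  have hνZ : ∀ i, ν (.Z i) = 0 := fun i => hν (.inr i)
  obtain ⟨e1, e2, e3, e4⟩ := weight_spreadDegree_eq h
  simp only [hμU, hνU, hμZ, hνZ] at e1 e2 e3 e4
  refine ext_of_eq (by omega) (by omega) (fun j => e4 j) (fun j => by rw [hμU, hνU])
    ?_ ?_ ?_ ?_ (by omega) <;> rw [hμZ, hνZ]

end Positions

/-! ### The height and the count for the split spread ideal -/

section Main

variable {k : Type*} [Field k] {n : ℕ} {v : Fin (2 * n + 7) → ℕ}

theorem splitSpreadIdeal_eq (k : Type*) [Field k] (n : ℕ) (v : Fin (2 * n + 7) → ℕ) :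
    splitSpreadIdeal k n v =
      (toricIdeal k (spreadDegree n ∘ (UVar.posEquiv n).symm)).map (split k v) := by
  rw [splitSpreadIdeal, spreadIdeal_eq, ← toricIdeal_map_rename]
  rfl

theorem height_splitSpreadIdeal (z : ∀ i, Fin (v i)) :
    (splitSpreadIdeal k n v).height = ((n + 4 : ℕ) : ℕ∞) := by
  classical
  let e := UVar.posEquiv n
  let W : Finset (Fin (2 * n + 7)) :=
    Finset.univ.map ⟨e ∘ relVar n, e.injective.comp relVar_injective⟩
  have hW : ∀ i, i ∈ W ↔ ∃ s, e (relVar n s) = i := fun i => by simp [W]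
  have hcard : W.card = n + 4 := by simp [W]
  have hsymm : (spreadDegree n ∘ e.symm) ∘ e = spreadDegree n := by
    funext x
    simp
  have hd : ∀ x, (spreadDegree n ∘ e.symm) (e x) = spreadDegree n x := congrFun hsymm
  rw [splitSpreadIdeal_eq, height_map_split_toricIdeal z (W := W) (t := e .T) ?_
    (fun i => (relExp (e.symm i)).mapDomain e) ?_ ?_ ?_, hcard]
  · rw [hW]
    rintro ⟨s | s, hs⟩ <;> simpa [relVar] using e.injective hs
  · intro i hi
    obtain ⟨s, rfl⟩ := (hW i).1 hi
    rw [weight_mapDomain, hsymm, Equiv.symm_apply_apply, weight_relExp]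
    exact congrArg₂ (· + ·) (hd _).symm (hd _).symm
  · intro i hi j hj
    obtain ⟨s, rfl⟩ := (hW i).1 hi
    obtain ⟨s', rfl⟩ := (hW j).1 hj
    rw [Equiv.symm_apply_apply, Finsupp.mapDomain_apply e.injective, relExp_relVar_apply]
  · intro μ ν hμ hν h
    rw [← weight_mapDomain, ← weight_mapDomain] at h
    have h' : ∀ (γ : Fin (2 * n + 7) →₀ ℕ) s,
        γ.mapDomain e.symm (relVar n s) = γ (e (relVar n s)) := fun γ s => by
      conv_lhs => rw [← e.symm_apply_apply (relVar n s)]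
      rw [Finsupp.mapDomain_apply e.symm.injective]
    refine Finsupp.mapDomain_injective e.symm.injective (eq_of_weight_eq (fun s => ?_)
      (fun s => ?_) h)
    · rw [h']
      exact hμ _ ((hW _).2 ⟨s, rfl⟩)
    · rw [h']
      exact hν _ ((hW _).2 ⟨s, rfl⟩)

theorem le_encard_embeddedPrimes (hn : 1 ≤ n) (z : ∀ i, Fin (v i)) {i₀ i₁ : Fin (2 * n + 7)}
    (h₀ : (i₀ : ℕ) = 0) (h₁ : (i₁ : ℕ) = 1) :
    ((∏ i, v i + v i₀ * v i₁ *
      ∏ i ∈ Finset.univ.filter (fun i : Fin (2 * n + 7) => n + 2 ≤ (i : ℕ)), v i : ℕ) : ℕ∞) ≤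
      (embeddedPrimes (splitSpreadIdeal k n v ^ 2)).encard := by
  rw [splitSpreadIdeal_eq, ← prod_filter_eq v h₀ h₁]
  have h1 := colon_rename (UVar.posEquiv n) (mul_witnessAll_mem_iff (k := k) (n := n))
  have h2 := colon_rename (UVar.posEquiv n) (mul_witnessNoC_mem_iff (k := k) (n := n))
  rw [image_pos_compl_range_c] at h2
  rw [Set.image_univ, (UVar.posEquiv n).range_eq_univ, ← Finset.coe_univ] at h1
  refine card_le_encard_embeddedPrimes z ?_ ?_ ?_ h1 h2
  · intro h
    -- Position 2 is that of `c₁`, which exists because `n ≥ 1`; it is absent from the second set.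
    have := h ▸ Finset.mem_univ (⟨2, by omega⟩ : Fin (2 * n + 7))
    simp at this
    omega
  · exact ⟨i₀, Finset.mem_univ _⟩
  · exact ⟨i₀, by simp [h₀]⟩

end Main

end

end SpreadSplit

theorem theorem4p3 (k : Type*) [Field k] (n : ℕ) (hn : 1 ≤ n)
    (v : Fin (2 * n + 7) → ℕ) (hv : ∀ i, 0 < v i) :
    ∃ P : Ideal (MvPolynomial (Σ i : Fin (2 * n + 7), Fin (v i)) k),
      P = SpreadSplit.splitSpreadIdeal k n v ∧
      P.IsPrime ∧
      P.height = ((n + 4 : ℕ) : ℕ∞) ∧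
      (((∏ i, v i) + v ⟨0, by omega⟩ * v ⟨1, by omega⟩ *
          ∏ i ∈ Finset.univ.filter (fun i : Fin (2 * n + 7) => n + 2 ≤ (i : ℕ)), v i : ℕ) : ℕ∞) ≤
        (SpreadSplit.embeddedPrimes (P ^ 2)).encard ∧
      ∀ w : ℕ, (∀ i, v i = w) →
        ((w ^ (2 * n + 7) + w ^ (n + 7) : ℕ) : ℕ∞) ≤
          (SpreadSplit.embeddedPrimes (P ^ 2)).encard := by
  have z : ∀ i, Fin (v i) := fun i => ⟨0, hv i⟩
  have key := SpreadSplit.le_encard_embeddedPrimes (k := k) hn z (i₀ := ⟨0, by omega⟩)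
    (i₁ := ⟨1, by omega⟩) rfl rfl
  refine ⟨_, rfl, ?_, SpreadSplit.height_splitSpreadIdeal z, key, fun w hw => ?_⟩
  · rw [SpreadSplit.splitSpreadIdeal_eq]
    exact SpreadSplit.map_split_toricIdeal_isPrime z _
  · convert key using 2
    -- The second product has `n + 5` factors, and `a`, `b` contribute two more.
    simp only [hw, Finset.prod_const, Finset.card_univ, Fintype.card_fin,
      SpreadSplit.card_filter_eq]
    ring
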